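/- Let $n\ge 1$ be an integer, $\alpha,\beta>0$, $N=\binom n2$. The dynamic Erdős–Rényi graph on $n$ vertices is the process $G(t)=(\chi_e(t))_e$, $t\ge 0$, indexed by the $N$ unordered pairs $e$ of distinct vertices, with $\chi_e(t)\in\{0,1\}$ telling whether the edge $e$ is present at time $t$, that evolves as follows: independently for all $e$, the state of $e$ is updated at the points of a Poisson process of intensity $\alpha+\frac{\beta}{n-1}$; at each update, independently of the Poisson processes, of the other updates and of the initial state, the edge is made present with probability $p=\frac{\beta}{\beta+(n-1)\alpha}$ and absent with probability $1-p$; the initial state is independent of all updates. (For $n=1$ there are no pairs.) Let $\mathcal F_t$ be the $\sigma$-algebra generated by the initial state and by the update times and the outcomes of the updates up to time $t$. A random time $T\in[0,\infty]$ is a randomized stopping time if there is a $\sigma$-algebra $\mathcal G$ of events, independent of $\mathcal F_\infty=\sigma(\bigcup_t\mathcal F_t)$, with $\{T\le t\}\in\sigma(\mathcal F_t,\mathcal G)$ for all $t\ge0$. For an $(\mathcal F_t)$-adapted Markov process $X$ on a finite state space with a unique stationary distribution $\pi$, a strong stationary time is a randomized stopping time $T$ such that for all $0\le t<\infty$ and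 all states $y$ $$P(T\le t,\,X(T)=y\mid T<\infty)=P(T\le t\mid T<\infty)\,P(X(T)=y\mid T<\infty)=P(T\le t\mid T<\infty)\,\pi(y)$$ (no condition if $P(T<\infty)=0$). A fastest time to stationarity for $X$ is a strong stationary time $T$ with $P(T>t)\le P(T'>t)$ for all $t\ge 0$ and every strong stationary time $T'$. Theorem. Suppose that $P(G(0)=\sigma)=1$ for some fixed state $\sigma$, and let $T_e$ be the time of the first update of the pair $e$. Then each edge process $\chi_e$ has a unique stationary distribution and $T_e$ is a fastest time to stationarity for $\chi_e$. The graph process $G$ has a unique stationary distribution, and $$T_s=\max_e T_e$$ (with $T_s=0$ if $n=1$) is a fastest time to stationarity for $G$. Furthermore, for all $t\ge 0$, $$P(T_s\le t)=\bigl(1-e^{-(\alpha+\frac{\beta}{n-1})t}\bigr)^{N},$$ where for $n=1$, i.e. $N=0$, the right-hand side is $1$. -/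

import Mathlib

open MeasureTheory ProbabilityTheory Set
open scoped NNReal ENNReal

noncomputable section

/-! ### Strong stationary times -/

section StrongStationary

variable {Ω : Type*} {m : MeasurableSpace Ω}

/-- `T : Ω → [0,∞]` is a randomized stopping time relative to the filtration `F`: for some
σ-algebra `𝒢` independent of `F_∞`, each event `{T ≤ t}` belongs to `σ(F t, 𝒢)`. -/
def IsRandomizedStoppingTime (μ : Measure Ω) (F : Filtration ℝ≥0 m) (T : Ω → ℝ≥0∞) : Prop :=
  ∃ 𝒢 : MeasurableSpace Ω, 𝒢 ≤ m ∧ Indep 𝒢 (⨆ t, F t) μ ∧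
    ∀ t : ℝ≥0, MeasurableSet[F t ⊔ 𝒢] {ω | T ω ≤ (t : ℝ≥0∞)}

variable {S : Type*} [Fintype S]

/-- `π` is a stationary distribution for the transition function `K`, where `K t x y` is the
probability to be in `y` after a time `t` when starting in `x`. -/
def IsStationaryDistribution (K : ℝ≥0 → S → S → ℝ≥0∞) (π : PMF S) : Prop :=
  ∀ (t : ℝ≥0) (y : S), ∑ x, π x * K t x y = π y

/-- `π` is the only stationary distribution for the transition function `K`. -/
def IsUniqueStationaryDistribution (K : ℝ≥0 → S → S → ℝ≥0∞) (π : PMF S) : Prop :=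
  ∀ ρ : PMF S, IsStationaryDistribution K ρ ↔ ρ = π

variable [MeasurableSpace S]

/-- `T` is a strong stationary time for the `F`-adapted process `X` with stationary distribution
`π`: it is a randomized stopping time and, given `T < ∞`, the state `X(T)` has law `π` and is
independent of `T`. The state at time `T` is read off at `(T ω).toNNReal`, which is `T ω` on the
event `T < ∞` on which we condition. -/
structure IsStrongStationaryTime (μ : Measure Ω) (F : Filtration ℝ≥0 m) (X : ℝ≥0 → Ω → S)
    (π : PMF S) (T : Ω → ℝ≥0∞) : Prop where
  adapted : ∀ t, Measurable[F t] (X t)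
  randomizedStoppingTime : IsRandomizedStoppingTime μ F T
  indep : ∀ (t : ℝ≥0) (y : S),
    (μ[|{ω | T ω < ∞}]) {ω | T ω ≤ (t : ℝ≥0∞) ∧ X (T ω).toNNReal ω = y} =
      (μ[|{ω | T ω < ∞}]) {ω | T ω ≤ (t : ℝ≥0∞)} *
        (μ[|{ω | T ω < ∞}]) {ω | X (T ω).toNNReal ω = y}
  law : ∀ (t : ℝ≥0) (y : S),
    (μ[|{ω | T ω < ∞}]) {ω | T ω ≤ (t : ℝ≥0∞)} *
        (μ[|{ω | T ω < ∞}]) {ω | X (T ω).toNNReal ω = y} =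
      (μ[|{ω | T ω < ∞}]) {ω | T ω ≤ (t : ℝ≥0∞)} * π y

/-- `T` is the fastest time to stationarity for `X`: a strong stationary time that is
stochastically smaller than every other strong stationary time. -/
def IsFastestTimeToStationarity (μ : Measure Ω) (F : Filtration ℝ≥0 m) (X : ℝ≥0 → Ω → S)
    (π : PMF S) (T : Ω → ℝ≥0∞) : Prop :=
  IsStrongStationaryTime μ F X π T ∧
    ∀ T' : Ω → ℝ≥0∞, IsStrongStationaryTime μ F X π T' →
      ∀ t : ℝ≥0, μ {ω | (t : ℝ≥0∞) < T ω} ≤ μ {ω | (t : ℝ≥0∞) < T' ω}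

end StrongStationary

/-! ### The dynamic Erdős–Rényi graph -/

/-- A Poisson process of intensity `r` on `[0,∞)`, given through its counting process: `N t` is
the number of points in `(0, t]`. Truncated subtraction on `ℕ` is harmless since the paths are
monotone. -/
structure IsPoissonProcess {Ω : Type*} [MeasurableSpace Ω] (N : ℝ≥0 → Ω → ℕ) (r : ℝ)
    (μ : Measure Ω) : Prop where
  measurable : ∀ t, Measurable (N t)
  zero : ∀ ω, N 0 ω = 0
  monotone : ∀ ω, Monotone fun t => N t ω
  rightContinuous : ∀ ω t, ContinuousWithinAt (fun s => N s ω) (Ici t) t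
  indepIncrements : HasIndepIncrements N μ
  increment_law : ∀ s t : ℝ≥0, s ≤ t →
    HasLaw (fun ω => N t ω - N s ω) (poissonMeasure (Real.toNNReal (r * ((t : ℝ) - s)))) μ

/-- The unordered pairs of distinct vertices of a graph on `n` vertices. -/
abbrev VertexPair (n : ℕ) : Type := {e : Sym2 (Fin n) // ¬ e.IsDiag}

/-- The states of a graph on `n` vertices: for every vertex pair, whether the edge is present. -/
abbrev GraphState (n : ℕ) : Type := VertexPair n → Bool

/-- The update rate `α + β / (n - 1)` of a vertex pair. -/
def updateRate (n : ℕ) (α β : ℝ) : ℝ := α + β / ((n : ℝ) - 1)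

/-- The probability `β / (β + (n - 1) α)` that an update makes the edge present. -/
def edgeProb (n : ℕ) (α β : ℝ) : ℝ := β / (β + ((n : ℝ) - 1) * α)

/-- The dynamic Erdős–Rényi graph: independently for all vertex pairs `e`, the state of `e` is
updated at the points of a Poisson process `N e` of intensity `α + β / (n - 1)`; the `k`-th update
(counted from `0`) sets the state to `mark e k`. The marks are independent, equal to `true` with
probability `β / (β + (n - 1) α)`, and independent of the Poisson processes. The initial state is
independent of all updates. -/
structure DynamicERGraph {Ω : Type*} [m : MeasurableSpace Ω] (n : ℕ) (α β : ℝ)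
    (μ : Measure Ω) where
  /-- the initial graph -/
  init : Ω → GraphState n
  /-- `N e t` is the number of updates of `e` in `(0, t]` -/
  N : VertexPair n → ℝ≥0 → Ω → ℕ
  /-- `mark e k` is the state of `e` right after its `k`-th update -/
  mark : VertexPair n → ℕ → Ω → Bool
  measurable_init : Measurable init
  measurable_mark : ∀ e k, Measurable (mark e k)
  poisson : ∀ e, IsPoissonProcess (N e) (updateRate n α β) μ
  mark_law : ∀ e k, μ {ω | mark e k ω = true} = ENNReal.ofReal (edgeProb n α β)
  indep_N : iIndepFun (fun (e : VertexPair n) (ω : Ω) (t : ℝ≥0) => N e t ω) μ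
  indep_mark : iIndepFun (fun (i : VertexPair n × ℕ) (ω : Ω) => mark i.1 i.2 ω) μ
  indep_N_mark : IndepFun (fun (ω : Ω) (e : VertexPair n) (t : ℝ≥0) => N e t ω)
    (fun (ω : Ω) (e : VertexPair n) (k : ℕ) => mark e k ω) μ
  indep_init : IndepFun init
    (fun ω => ((fun (e : VertexPair n) (t : ℝ≥0) => N e t ω),
      (fun (e : VertexPair n) (k : ℕ) => mark e k ω))) μ

namespace DynamicERGraph

variable {Ω : Type*} [m : MeasurableSpace Ω] {n : ℕ} {α β : ℝ} {μ : Measure Ω}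
  (D : DynamicERGraph n α β μ)

/-- The state at time `t` of the pair `e` when its state at time `0` is `b`: the outcome of the
last update, or `b` if there has been none. -/
def edgeFrom (b : Bool) (e : VertexPair n) (t : ℝ≥0) (ω : Ω) : Bool :=
  match D.N e t ω with
  | 0 => b
  | k + 1 => D.mark e k ω

/-- The edge process `χ_e`. -/
def edge (e : VertexPair n) (t : ℝ≥0) (ω : Ω) : Bool := D.edgeFrom (D.init ω e) e t ω

/-- The graph process `G(t) = (χ_e(t))_e`. -/
def graph (t : ℝ≥0) (ω : Ω) : GraphState n := fun e => D.edge e t ω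

/-- Transition function of the edge process of `e`: the probability that it is in `b` at time `t`
when started in `a`. -/
def edgeTransition (e : VertexPair n) (t : ℝ≥0) (a b : Bool) : ℝ≥0∞ :=
  μ {ω | D.edgeFrom a e t ω = b}

/-- Transition function of the graph process: the probability that it is in `y` at time `t` when
started in `x`. -/
def graphTransition (t : ℝ≥0) (x y : GraphState n) : ℝ≥0∞ :=
  μ {ω | (fun e => D.edgeFrom (x e) e t ω) = y}

/-- The events that are determined by the initial state or by one update up to time `t`. -/
def basicEvents (t : ℝ≥0) : Set (Set Ω) :=
  {A | ∃ B : Set (GraphState n), A = D.init ⁻¹' B} ∪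
  {A | ∃ (e : VertexPair n) (s : ℝ≥0) (k : ℕ), s ≤ t ∧
    (A = {ω | k < D.N e s ω} ∨ A = {ω | k < D.N e s ω ∧ D.mark e k ω = true})}

/-- The filtration `(F_t)` of information generated by the initial state and by the update times
and the outcomes of the updates up to time `t`. -/
def filtration : Filtration ℝ≥0 m where
  seq t := MeasurableSpace.generateFrom (D.basicEvents t)
  mono' := by
    intro s t hst
    refine MeasurableSpace.generateFrom_mono ?_
    rintro A (hA | ⟨e, u, k, hu, hA⟩)
    · exact Or.inl hA
    · exact Or.inr ⟨e, u, k, hu.trans hst, hA⟩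
  le' := by
    intro t
    refine MeasurableSpace.generateFrom_le ?_
    rintro A (⟨B, rfl⟩ | ⟨e, u, k, -, hA⟩)
    · exact D.measurable_init (Set.toFinite B).measurableSet
    · have h1 : MeasurableSet {ω | k < D.N e u ω} :=
        measurableSet_lt measurable_const ((D.poisson e).measurable u)
      have h2 : MeasurableSet {ω | D.mark e k ω = true} :=
        D.measurable_mark e k (measurableSet_singleton true)
      rcases hA with rfl | rfl
      · exact h1
      · exact h1.inter h2

/-- The time `T_e` of the first update of the pair `e` (`∞` if there is none). -/
def firstUpdate (e : VertexPair n) (ω : Ω) : ℝ≥0∞ :=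
  ⨅ (t : ℝ≥0) (_ : 1 ≤ D.N e t ω), (t : ℝ≥0∞)

/-- `T_s`, the maximum of the first update times over all vertex pairs. -/
def maxFirstUpdate (ω : Ω) : ℝ≥0∞ := ⨆ e : VertexPair n, D.firstUpdate e ω

end DynamicERGraph

end

/-! ### Independence of suprema of σ-algebras -/

section Independence

variable {Ω : Type*} {mΩ : MeasurableSpace Ω} {μ : Measure Ω}

/-! Let `T` be the first time at which all pairs of a finite set have been updated. It is a function
of the Poisson processes alone, and so are the indices of the last updates before `T`. Since the
outcomes are independent of the Poisson processes, the states of these pairs at time `T` are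
independent updates, independent of `T` (`measure_edges_at_updateTime`). Hence `T` is a strong
stationary time: one pair gives the edge statement, all pairs give the graph statement.

Optimality rests on the separation bound `IsStrongStationaryTime.measure_le_mul_le`: every strong
stationary time `T'` satisfies `P(T' ≤ t) π(y) ≤ P(X(t) = y)`, because on `{T' ≤ t}` the process is
in equilibrium at `T'` and remains so until `t`. A strong stationary time that attains equality at
some `y` with `π y ≠ 0`, for all `t`, is therefore fastest. Started from `σ`, the complementary
state does this: each pair must have been updated to reach it, so its probability at time `t` is
exactly `P(T ≤ t) π(y)`.

The bound uses the Markov property relative to the filtration enlarged by the extra randomness of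
`T'`. For the graph, the Markov property comes from fixing the numbers of updates up to time `s`:
then the history sees the outcomes up to these indices and the future only later ones
(`indep_historyAlg_futureAlg`, `measurableSet_historyAlg_inter`). Uniqueness of the stationary
distribution is a Doeblin argument: `K t x y ≥ c π(y)`, where `c` is the probability that all pairs
involved have been updated, which tends to 1. -/

lemma isPiSystem_image2_inter (a c : MeasurableSpace Ω) :
    IsPiSystem (image2 (· ∩ ·) {s | MeasurableSet[a] s} {s | MeasurableSet[c] s}) := by
  rintro _ ⟨u, hu, v, hv, rfl⟩ _ ⟨u', hu', v', hv', rfl⟩ -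
  exact ⟨u ∩ u', MeasurableSet.inter (m := a) hu hu', v ∩ v', MeasurableSet.inter (m := c) hv hv',
    inter_inter_inter_comm _ _ _ _⟩

lemma sup_eq_generateFrom_image2_inter (a c : MeasurableSpace Ω) :
    a ⊔ c = MeasurableSpace.generateFrom
      (image2 (· ∩ ·) {s | MeasurableSet[a] s} {s | MeasurableSet[c] s}) := by
  apply le_antisymm
  · refine sup_le (fun s hs => ?_) (fun s hs => ?_)
    · exact MeasurableSpace.measurableSet_generateFrom
        ⟨s, hs, univ, @MeasurableSet.univ _ c, inter_univ s⟩
    · exact MeasurableSpace.measurableSet_generateFrom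
        ⟨univ, @MeasurableSet.univ _ a, s, hs, univ_inter s⟩
  · refine MeasurableSpace.generateFrom_le ?_
    rintro _ ⟨u, hu, v, hv, rfl⟩
    have h1 : MeasurableSet[a ⊔ c] u := (le_sup_left : a ≤ a ⊔ c) u hu
    have h2 : MeasurableSet[a ⊔ c] v := (le_sup_right : c ≤ a ⊔ c) v hv
    exact MeasurableSet.inter (m := a ⊔ c) h1 h2

/-- On rectangles, independence of `a ⊔ b` and `c ⊔ d` separates the `a, b` factors from the `c, d`
factors; each group then splits by `hab` or `hcd`, and the four factors regroup. -/
lemma indep_sup_sup [IsProbabilityMeasure μ] {a b c d : MeasurableSpace Ω}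
    (ha : a ≤ mΩ) (hb : b ≤ mΩ) (hc : c ≤ mΩ) (hd : d ≤ mΩ)
    (hab : Indep a b μ) (hcd : Indep c d μ) (h : Indep (a ⊔ b) (c ⊔ d) μ) :
    Indep (a ⊔ c) (b ⊔ d) μ := by
  refine IndepSets.indep (sup_le ha hc) (sup_le hb hd) (isPiSystem_image2_inter a c)
    (isPiSystem_image2_inter b d) (sup_eq_generateFrom_image2_inter a c)
    (sup_eq_generateFrom_image2_inter b d) ?_
  rw [IndepSets_iff]
  rintro _ _ ⟨u, hu, v, hv, rfl⟩ ⟨u', hu', v', hv', rfl⟩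
  rw [Indep_iff] at hab hcd h
  have hu1 : MeasurableSet[a ⊔ b] u := (le_sup_left : a ≤ a ⊔ b) u hu
  have hu2 : MeasurableSet[a ⊔ b] u' := (le_sup_right : b ≤ a ⊔ b) u' hu'
  have hv1 : MeasurableSet[c ⊔ d] v := (le_sup_left : c ≤ c ⊔ d) v hv
  have hv2 : MeasurableSet[c ⊔ d] v' := (le_sup_right : d ≤ c ⊔ d) v' hv'
  simp only
  rw [inter_inter_inter_comm,
    h _ _ (MeasurableSet.inter (m := a ⊔ b) hu1 hu2) (MeasurableSet.inter (m := c ⊔ d) hv1 hv2),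
    hab _ _ hu hu', hcd _ _ hv hv', h _ _ hu1 hv1, h _ _ hu2 hv2]
  ring

lemma indep_iSup_iSup_of_iIndep [IsProbabilityMeasure μ] {ι : Type*} [Fintype ι]
    {a b : ι → MeasurableSpace Ω} (ha : ∀ i, a i ≤ mΩ) (hb : ∀ i, b i ≤ mΩ)
    (hab : ∀ i, Indep (a i) (b i) μ) (h : iIndep (fun i => a i ⊔ b i) μ) :
    Indep (⨆ i, a i) (⨆ i, b i) μ := by
  classical
  suffices H : ∀ S : Finset ι, Indep (⨆ i ∈ S, a i) (⨆ i ∈ S, b i) μ by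
    simpa using H Finset.univ
  intro S
  induction S using Finset.induction_on with
  | empty => simpa using indep_bot_left _
  | insert j S hj ih =>
    rw [Finset.iSup_insert, Finset.iSup_insert]
    refine indep_sup_sup (ha j) (hb j) (iSup₂_le fun i _ => ha i) (iSup₂_le fun i _ => hb i)
      (hab j) ih ?_
    have hd : Disjoint ({j} : Set ι) (S : Set ι) := by simpa using hj
    have := indep_iSup_of_disjoint (fun i => sup_le (ha i) (hb i)) h hd
    simpa [iSup_sup_eq] using this

lemma iIndep_sup [IsProbabilityMeasure μ] {ι : Type*} {a c : ι → MeasurableSpace Ω}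
    (ha : ∀ i, a i ≤ mΩ) (hc : ∀ i, c i ≤ mΩ) (hia : iIndep a μ) (hic : iIndep c μ)
    (h : Indep (⨆ i, a i) (⨆ i, c i) μ) : iIndep (fun i => a i ⊔ c i) μ := by
  refine iIndepSets.iIndep (fun i => sup_le (ha i) (hc i)) _
    (fun i => isPiSystem_image2_inter (a i) (c i))
    (fun i => sup_eq_generateFrom_image2_inter (a i) (c i)) ?_
  rw [iIndepSets_iff]
  intro S f hf
  -- `f i` is constrained only for `i ∈ S`; `univ` elsewhere makes the chosen families total.
  have hf' : ∀ i, ∃ u v, MeasurableSet[a i] u ∧ MeasurableSet[c i] v ∧ (i ∈ S → u ∩ v = f i) := by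
    intro i
    by_cases hi : i ∈ S
    · obtain ⟨u, hu, v, hv, huv⟩ := hf i hi
      exact ⟨u, v, hu, hv, fun _ => huv⟩
    · exact ⟨univ, univ, @MeasurableSet.univ _ (a i), @MeasurableSet.univ _ (c i),
        fun h => absurd h hi⟩
  choose u v hu hv huv using hf'
  rw [Indep_iff] at h
  have hle : ∀ (m : ι → MeasurableSpace Ω) (w : ι → Set Ω), (∀ i, MeasurableSet[m i] (w i)) →
      MeasurableSet[⨆ i, m i] (⋂ i ∈ S, w i) := fun m w hw =>
    Finset.measurableSet_biInter (m := ⨆ i, m i) S fun i _ => le_iSup m i _ (hw i)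
  have hau : ∀ i, MeasurableSet[⨆ i, a i] (u i) := fun i => le_iSup a i _ (hu i)
  have hcv : ∀ i, MeasurableSet[⨆ i, c i] (v i) := fun i => le_iSup c i _ (hv i)
  have e1 : ⋂ i ∈ S, f i = (⋂ i ∈ S, u i) ∩ ⋂ i ∈ S, v i := by
    rw [← iInter₂_congr huv]
    ext ω
    simp [forall_and]
  rw [e1, h _ _ (hle a u hu) (hle c v hv), hia.meas_biInter fun i _ => hu i,
    hic.meas_biInter fun i _ => hv i, ← Finset.prod_mul_distrib]
  exact Finset.prod_congr rfl fun i hi => by rw [← huv i hi, h _ _ (hau i) (hcv i)]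

lemma iIndep_iSup_prod [IsProbabilityMeasure μ] {ι κ : Type*} {c : ι × κ → MeasurableSpace Ω}
    (hc : ∀ i, c i ≤ mΩ) (h : iIndep c μ) : iIndep (fun i => ⨆ k, c (i, k)) μ := by
  classical
  rw [iIndep_iff]
  intro S f hf
  induction S using Finset.induction_on with
  | empty => simp
  | insert j S hj ih =>
    have hd : Disjoint {p : ι × κ | p.1 = j} {p | p.1 ∈ S} := by
      rw [Set.disjoint_left]
      rintro p rfl hp
      exact hj hp
    have h1 := (Indep_iff _ _ _).1 (indep_iSup_of_disjoint hc h hd)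
    have hle : ∀ i (P : Set (ι × κ)), (∀ k, (i, k) ∈ P) → ⨆ k, c (i, k) ≤ ⨆ p ∈ P, c p :=
      fun i P hP => iSup_le fun k => le_iSup₂ (f := fun p (_ : p ∈ P) => c p) (i, k) (hP k)
    rw [Finset.set_biInter_insert, Finset.prod_insert hj,
      h1 _ _ (hle j _ (fun _ => rfl) _ (hf j (Finset.mem_insert_self j S)))
        (Finset.measurableSet_biInter (m := ⨆ p ∈ {p : ι × κ | p.1 ∈ S}, c p) S fun i hi =>
          hle i _ (fun _ => hi) _ (hf i (Finset.mem_insert_of_mem hi))),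
      ih fun i hi => hf i (Finset.mem_insert_of_mem hi)]

end Independence

/-! ### Right-continuous processes at random times -/

section RandomTime

/-- Round up to the next multiple of `1 / (k + 1)`. -/
noncomputable def roundUp (k : ℕ) (x : ℝ≥0) : ℝ≥0 := (⌈x * (k + 1)⌉₊ : ℝ≥0) / (k + 1)

lemma le_roundUp (k : ℕ) (x : ℝ≥0) : x ≤ roundUp k x := by
  rw [roundUp, le_div_iff₀ (by positivity)]
  exact Nat.le_ceil _

lemma tendsto_roundUp (x : ℝ≥0) :
    Filter.Tendsto (fun k => roundUp k x) Filter.atTop (nhdsWithin x (Ici x)) := by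
  refine tendsto_nhdsWithin_iff.2 ⟨?_, Filter.Eventually.of_forall fun k => le_roundUp k x⟩
  have h0 : Filter.Tendsto (fun k : ℕ => x + 1 / ((k : ℝ≥0) + 1)) Filter.atTop (nhds (x + 0)) :=
    tendsto_const_nhds.add (tendsto_one_div_add_atTop_nhds_zero_nat (𝕜 := ℝ≥0))
  rw [add_zero] at h0
  refine tendsto_of_tendsto_of_tendsto_of_le_of_le tendsto_const_nhds h0
    (fun k => le_roundUp k x) (fun k => ?_)
  have hk : (0 : ℝ≥0) < k + 1 := by positivity
  simp only [roundUp]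
  rw [div_le_iff₀ hk, add_mul, one_div, inv_mul_cancel₀ hk.ne']
  exact (Nat.ceil_lt_add_one (by positivity)).le

variable {Ω S : Type*} {m : MeasurableSpace Ω} [MeasurableSpace S]

lemma measurable_eval_of_countable {X : ℝ≥0 → Ω → S} (hX : ∀ t, Measurable (X t)) {J : Ω → ℕ}
    (hJ : Measurable J) (s : ℕ → ℝ≥0) : Measurable fun ω => X (s (J ω)) ω := by
  have h : Measurable fun p : ℕ × Ω => X (s p.1) p.2 :=
    measurable_from_prod_countable_right fun j => hX (s j)
  exact h.comp (hJ.prodMk measurable_id)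

/-- Right-continuity in the sense of `hr` makes `X` at the rounded times eventually equal to `X` at
`τ`, so `{X τ = x}` is the liminf of events at countably valued times. -/
lemma measurable_eval_randomTime [Countable S] [MeasurableSingletonClass S]
    {X : ℝ≥0 → Ω → S} (hX : ∀ t, Measurable (X t))
    (hr : ∀ ω t, ∀ᶠ s in nhdsWithin t (Ici t), X s ω = X t ω) {τ : Ω → ℝ≥0} (hτ : Measurable τ) :
    Measurable fun ω => X (τ ω) ω := by
  refine measurable_to_countable' fun x => ?_
  have hk : ∀ k, Measurable fun ω => X (roundUp k (τ ω)) ω := fun k =>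
    measurable_eval_of_countable hX (J := fun ω => ⌈τ ω * (k + 1)⌉₊)
      (Nat.measurable_ceil.comp (hτ.mul_const _)) fun j => (j : ℝ≥0) / (k + 1)
  have e : (fun ω => X (τ ω) ω) ⁻¹' {x} =
      {ω | ∀ᶠ k in Filter.atTop, ω ∈ (fun ω => X (roundUp k (τ ω)) ω) ⁻¹' {x}} := by
    ext ω
    have h := (tendsto_roundUp (τ ω)).eventually (hr ω (τ ω))
    simp only [mem_preimage, mem_singleton_iff, mem_ofPred_eq]
    constructor
    · intro hx
      filter_upwards [h] with k hk using hk.trans hx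
    · intro hx
      obtain ⟨k, h1, h2⟩ := (h.and hx).exists
      exact h1.symm.trans h2
  rw [e]
  have : {ω | ∀ᶠ k in Filter.atTop, ω ∈ (fun ω => X (roundUp k (τ ω)) ω) ⁻¹' {x}} =
      ⋃ i : ℕ, ⋂ k : ℕ, ⋂ _ : i ≤ k, (fun ω => X (roundUp k (τ ω)) ω) ⁻¹' {x} := by
    ext ω
    simp [Filter.eventually_atTop]
  rw [this]
  exact MeasurableSet.iUnion fun i => MeasurableSet.iInter fun k => MeasurableSet.iInter fun _ =>
    hk k (measurableSet_singleton x)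

end RandomTime

/-! ### The separation bound for strong stationary times -/

section SeparationBound

lemma toNNReal_le_iff {a : ℝ≥0∞} (ha : a ≠ ∞) {b : ℝ≥0} : a.toNNReal ≤ b ↔ a ≤ b := by
  rw [← ENNReal.coe_le_coe, ENNReal.coe_toNNReal ha]

lemma measure_eq_tsum_inter_fiber {Ω ι : Type*} [Countable ι] {m : MeasurableSpace Ω}
    (μ : Measure Ω) {J : Ω → ι} (hJ : ∀ i, MeasurableSet {ω | J ω = i}) (A : Set Ω) :
    μ A = ∑' i, μ (A ∩ {ω | J ω = i}) := by
  -- Additivity is applied to the restricted measure, so that only the fibres, not `A`, need be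
  -- measurable.
  have h : (μ.restrict A) (⋃ i, {ω | J ω = i}) = ∑' i, (μ.restrict A) {ω | J ω = i} := by
    refine measure_iUnion (fun i j hij => ?_) hJ
    rw [Function.onFun, Set.disjoint_left]
    rintro ω rfl h
    exact hij h
  have hu : (⋃ i, {ω | J ω = i}) = univ := by
    ext ω
    simp
  rw [hu, Measure.restrict_apply_univ] at h
  rw [h]
  exact tsum_congr fun i => by rw [Measure.restrict_apply (hJ i), inter_comm]

variable {Ω : Type*} {m : MeasurableSpace Ω} {μ : Measure Ω} {F : Filtration ℝ≥0 m}
  {S : Type*}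

/-- `X` is a Markov process with respect to the filtration `F` with transition function `K`. -/
def HasMarkovProperty (μ : Measure Ω) (F : Filtration ℝ≥0 m) (X : ℝ≥0 → Ω → S)
    (K : ℝ≥0 → S → S → ℝ≥0∞) : Prop :=
  ∀ ⦃s t : ℝ≥0⦄, s ≤ t → ∀ A, MeasurableSet[F s] A → ∀ x y,
    μ (A ∩ {ω | X s ω = x ∧ X t ω = y}) = μ (A ∩ {ω | X s ω = x}) * K (t - s) x y

variable [MeasurableSpace S] {X : ℝ≥0 → Ω → S}
  {K : ℝ≥0 → S → S → ℝ≥0∞}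

/-- Both sides are finite measures in `A`. On intersections of an `F s`-event with a `𝒢`-event,
independence factors out the latter; these intersections form a generating π-system. -/
lemma HasMarkovProperty.of_sup_indep
    [MeasurableSingletonClass S] [IsProbabilityMeasure μ] (hM : HasMarkovProperty μ F X K)
    (hX : ∀ t, Measurable[F t] (X t)) {𝒢 : MeasurableSpace Ω} (h𝒢 : 𝒢 ≤ m)
    (hind : Indep 𝒢 (⨆ t, F t) μ) {s t : ℝ≥0} (hst : s ≤ t) {A : Set Ω}
    (hA : MeasurableSet[F s ⊔ 𝒢] A) (x y : S) :
    μ (A ∩ {ω | X s ω = x ∧ X t ω = y}) = μ (A ∩ {ω | X s ω = x}) * K (t - s) x y := by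
  rw [Indep_iff] at hind
  have hxF : MeasurableSet[F s] {ω | X s ω = x} := hX s (measurableSet_singleton x)
  have hyF : MeasurableSet[F t] {ω | X t ω = y} := hX t (measurableSet_singleton y)
  have hF : ∀ r, F r ≤ ⨆ t, F t := fun r => le_iSup (fun t => (F t : MeasurableSpace Ω)) r
  have hle : F s ⊔ 𝒢 ≤ m := sup_le (F.le s) h𝒢
  have key : ∀ u v, MeasurableSet[F s] u → MeasurableSet[𝒢] v →
      μ (u ∩ v ∩ {ω | X s ω = x ∧ X t ω = y}) =
        K (t - s) x y * μ (u ∩ v ∩ {ω | X s ω = x}) := by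
    intro u v hu hv
    have h1 : MeasurableSet[⨆ t, F t] (u ∩ {ω | X s ω = x}) :=
      hF s _ (MeasurableSet.inter (m := F s) hu hxF)
    have h2 : MeasurableSet[⨆ t, F t] (u ∩ {ω | X s ω = x ∧ X t ω = y}) :=
      MeasurableSet.inter (m := ⨆ t, F t) (hF s _ hu)
        (MeasurableSet.inter (m := ⨆ t, F t) (hF s _ hxF) (hF t _ hyF))
    have e : ∀ B : Set Ω, u ∩ v ∩ B = v ∩ (u ∩ B) := fun B => by
      rw [inter_comm u v, inter_assoc]
    rw [e, e, hind _ _ hv h2, hind _ _ hv h1, hM hst u hu x y]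
    ring
  have h := ext_on_measurableSpace_of_generate_finite m
    (μ := μ.restrict {ω | X s ω = x ∧ X t ω = y})
    (ν := K (t - s) x y • μ.restrict {ω | X s ω = x}) _ ?_ hle
    (sup_eq_generateFrom_image2_inter (F s) 𝒢) (isPiSystem_image2_inter (F s) 𝒢) ?_ hA
  · rw [Measure.restrict_apply (hle _ hA), Measure.smul_apply, Measure.restrict_apply (hle _ hA),
      smul_eq_mul] at h
    rw [h, mul_comm]
  · rintro _ ⟨u, hu, v, hv, rfl⟩
    have huv : MeasurableSet[m] (u ∩ v) := MeasurableSet.inter (m := m) (F.le s _ hu) (h𝒢 _ hv)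
    simp only
    rw [Measure.restrict_apply huv, Measure.smul_apply, Measure.restrict_apply huv, smul_eq_mul]
    exact key u v hu hv
  · have := key univ univ (@MeasurableSet.univ _ (F s)) (@MeasurableSet.univ _ 𝒢)
    simpa using this

/-- The events covered here include the cells on which `T`, rounded up to a grid, takes a given
value. -/
lemma HasMarkovProperty.of_randomizedStoppingTime
    [MeasurableSingletonClass S] [IsProbabilityMeasure μ]
    (hM : HasMarkovProperty μ F X K) (hX : ∀ t, Measurable[F t] (X t)) {T : Ω → ℝ≥0∞}
    (hT : IsRandomizedStoppingTime μ F T) {s t : ℝ≥0} (hst : s ≤ t) {ι : Type*} (I : Finset ι)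
    {r : ι → ℝ≥0} (hr : ∀ i ∈ I, r i ≤ s) (x y : S) :
    μ (({ω | T ω ≤ s} \ ⋃ i ∈ I, {ω | T ω ≤ r i}) ∩ {ω | X s ω = x ∧ X t ω = y}) =
      μ (({ω | T ω ≤ s} \ ⋃ i ∈ I, {ω | T ω ≤ r i}) ∩ {ω | X s ω = x}) * K (t - s) x y := by
  obtain ⟨𝒢, h𝒢, hind, hT𝒢⟩ := hT
  refine hM.of_sup_indep hX h𝒢 hind hst (MeasurableSet.diff (m := F s ⊔ 𝒢) (hT𝒢 _)
    (Finset.measurableSet_biUnion (m := F s ⊔ 𝒢) _ fun i hi => ?_)) x y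
  exact sup_le_sup_right (F.mono (hr i hi)) 𝒢 _ (hT𝒢 _)

lemma IsRandomizedStoppingTime.measurable {T : Ω → ℝ≥0∞} (h : IsRandomizedStoppingTime μ F T) :
    Measurable T := by
  obtain ⟨𝒢, h𝒢, -, hT⟩ := h
  refine measurable_of_Iic fun a => ?_
  induction a with
  | top => simp
  | coe a => exact sup_le (F.le a) h𝒢 _ (hT a)

variable {π : PMF S} {T : Ω → ℝ≥0∞}

/-- Removes the conditioning on `{T < ∞}`: the normalizing constant cancels, and both sides vanish
if this event is null. -/
lemma IsStrongStationaryTime.measure_le_and_eq [IsProbabilityMeasure μ]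
    (h : IsStrongStationaryTime μ F X π T) (t : ℝ≥0) (x : S) :
    μ {ω | T ω ≤ t ∧ X (T ω).toNNReal ω = x} = μ {ω | T ω ≤ t} * π x := by
  have hT := h.randomizedStoppingTime.measurable
  have hE : MeasurableSet {ω | T ω < ∞} := measurableSet_lt hT measurable_const
  have h1 := (h.indep t x).trans (h.law t x)
  have hsub : {ω | T ω ≤ t} ⊆ {ω | T ω < ∞} := fun ω hω => lt_of_le_of_lt hω ENNReal.coe_lt_top
  rw [cond_apply hE, cond_apply hE, inter_eq_self_of_subset_right hsub,
    inter_eq_self_of_subset_right (fun ω hω => hsub hω.1), mul_assoc] at h1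
  by_cases h0 : μ {ω | T ω < ∞} = 0
  · rw [measure_mono_null (fun ω hω => hsub hω.1) h0, measure_mono_null hsub h0, zero_mul]
  · exact (ENNReal.mul_right_inj (ENNReal.inv_ne_zero.2 (measure_ne_top _ _))
      (ENNReal.inv_ne_top.2 h0)).1 h1

/-- A finite measure on `ℝ≥0` is determined by its values on the half-lines `Iic a`, so the identity
for `{T ≤ a}` extends to Borel sets of times. -/
lemma IsStrongStationaryTime.measure_mem_and_eq [Countable S]
    [MeasurableSingletonClass S] [IsProbabilityMeasure μ]
    (h : IsStrongStationaryTime μ F X π T)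
    (hr : ∀ ω t, ∀ᶠ s in nhdsWithin t (Ici t), X s ω = X t ω) {C : Set ℝ≥0}
    (hC : MeasurableSet C) (x : S) :
    μ {ω | (T ω < ∞ ∧ (T ω).toNNReal ∈ C) ∧ X (T ω).toNNReal ω = x} =
      μ {ω | T ω < ∞ ∧ (T ω).toNNReal ∈ C} * π x := by
  have hT := h.randomizedStoppingTime.measurable
  have hτ : Measurable fun ω => (T ω).toNNReal := hT.ennreal_toNNReal
  have hE : MeasurableSet {ω | T ω < ∞} := measurableSet_lt hT measurable_const
  have hx : MeasurableSet {ω | X (T ω).toNNReal ω = x} :=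
    measurable_eval_randomTime (fun t => (h.adapted t).mono (F.le t) le_rfl) hr hτ
      (measurableSet_singleton x)
  have hIic : ∀ (a : ℝ≥0) (ω : Ω), (T ω).toNNReal ≤ a ∧ T ω < ∞ ↔ T ω ≤ a := by
    intro a ω
    constructor
    · rintro ⟨h1, h2⟩
      exact (toNNReal_le_iff h2.ne).1 h1
    · intro h1
      exact ⟨(toNNReal_le_iff (lt_of_le_of_lt h1 ENNReal.coe_lt_top).ne).2 h1,
        lt_of_le_of_lt h1 ENNReal.coe_lt_top⟩
  have key : Measure.map (fun ω => (T ω).toNNReal)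
        (μ.restrict ({ω | T ω < ∞} ∩ {ω | X (T ω).toNNReal ω = x})) =
      Measure.map (fun ω => (T ω).toNNReal) (π x • μ.restrict {ω | T ω < ∞}) := by
    refine Measure.ext_of_Iic _ _ fun a => ?_
    rw [Measure.map_apply hτ measurableSet_Iic, Measure.map_apply hτ measurableSet_Iic,
      Measure.smul_apply, Measure.restrict_apply (hτ measurableSet_Iic),
      Measure.restrict_apply (hτ measurableSet_Iic), smul_eq_mul, mul_comm]
    convert h.measure_le_and_eq a x using 2
    · ext ω
      simp only [mem_inter_iff, mem_preimage, mem_Iic, mem_ofPred_eq, ← hIic, and_assoc]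
    · congr 1
      ext ω
      simp only [mem_inter_iff, mem_preimage, mem_Iic, mem_ofPred_eq, ← hIic]
  have h2 := congrArg (fun ν : Measure ℝ≥0 => ν C) key
  rw [Measure.map_apply hτ hC, Measure.map_apply hτ hC, Measure.smul_apply,
    Measure.restrict_apply (hτ hC), Measure.restrict_apply (hτ hC), smul_eq_mul, mul_comm] at h2
  convert h2 using 2
  · ext ω
    simp only [mem_inter_iff, mem_preimage, mem_ofPred_eq]
    tauto
  · congr 1
    ext ω
    simp only [mem_inter_iff, mem_preimage, mem_ofPred_eq]
    tauto

/-- The separation bound. In equilibrium at `T`, the process would still have law `π` at `t`, but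
the strong Markov property is not at hand. Hence `T` is rounded up to a grid of mesh `1 / (k + 1)`,
the Markov property is used at the grid times, and the probability that rounding changes the state
tends to 0. -/
lemma IsStrongStationaryTime.measure_le_mul_le [Fintype S]
    [MeasurableSingletonClass S] [IsProbabilityMeasure μ]
    (h : IsStrongStationaryTime μ F X π T) (hM : HasMarkovProperty μ F X K)
    (hK : ∀ t x y, K t x y ≤ 1) (hπ : IsStationaryDistribution K π)
    (hr : ∀ ω t, ∀ᶠ s in nhdsWithin t (Ici t), X s ω = X t ω) (t : ℝ≥0) (y : S) :
    μ {ω | T ω ≤ t} * π y ≤ μ {ω | X t ω = y} := by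
  have hT := h.randomizedStoppingTime.measurable
  have hτ : Measurable fun ω => (T ω).toNNReal := hT.ennreal_toNNReal
  have hXm : ∀ t, Measurable (X t) := fun t => (h.adapted t).mono (F.le t) le_rfl
  have hXτ : Measurable fun ω => X (T ω).toNNReal ω := measurable_eval_randomTime hXm hr hτ
  set E : Set Ω := {ω | T ω ≤ t} with hEdef
  have hE : MeasurableSet E := measurableSet_le hT measurable_const
  set J : ℕ → Ω → ℕ := fun k ω => ⌈(T ω).toNNReal * (k + 1)⌉₊ with hJdef
  have hJ : ∀ k, Measurable (J k) := fun k => Nat.measurable_ceil.comp (hτ.mul_const _)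
  -- Capping at `t` keeps the grid times in the range of the Markov property; on `{T ≤ t}` the
  -- capped time is still at least `T`.
  set s : ℕ → ℕ → ℝ≥0 := fun k j => min ((j : ℝ≥0) / (k + 1)) t with hsdef
  -- The exceptional event: rounding `T` has changed the observed state.
  set B : ℕ → Set Ω := fun k => E ∩ {ω | X (s k (J k ω)) ω ≠ X (T ω).toNNReal ω} with hBdef
  have hB : ∀ k, MeasurableSet (B k) := fun k =>
    hE.inter (measurableSet_eq_fun (measurable_eval_of_countable hXm (hJ k) (s k)) hXτ).compl
  have hTs : ∀ k i ω, T ω ≤ (s k i : ℝ≥0∞) ↔ T ω ≤ t ∧ J k ω ≤ i := by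
    intro k i ω
    have hk : (0 : ℝ≥0) < k + 1 := by positivity
    simp only [hJdef, hsdef, Nat.ceil_le, ENNReal.coe_min, le_min_iff]
    rw [and_comm]
    refine and_congr_right fun h1 => ?_
    rw [← le_div_iff₀ hk]
    have hne : T ω ≠ ∞ := (lt_of_le_of_lt h1 ENNReal.coe_lt_top).ne
    exact (toNNReal_le_iff hne).symm
  have hI : ∀ k j x, μ (E ∩ {ω | J k ω = j} ∩ {ω | X (s k j) ω = x ∧ X t ω = y}) =
      μ (E ∩ {ω | J k ω = j} ∩ {ω | X (s k j) ω = x}) * K (t - s k j) x y := by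
    intro k j x
    have e : E ∩ {ω | J k ω = j} =
        {ω | T ω ≤ (s k j : ℝ≥0∞)} \ ⋃ i ∈ Finset.range j, {ω | T ω ≤ (s k i : ℝ≥0∞)} := by
      ext ω
      simp only [hTs, mem_inter_iff, mem_sdiff, mem_iUnion, Finset.mem_range, mem_ofPred_eq, hEdef]
      constructor
      · rintro ⟨h1, h2⟩
        refine ⟨⟨h1, h2.le⟩, ?_⟩
        rintro ⟨i, hi, -, hi'⟩
        omega
      · rintro ⟨⟨h1, h2⟩, h3⟩
        refine ⟨h1, le_antisymm h2 ?_⟩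
        by_contra hlt
        exact h3 ⟨J k ω, not_le.1 hlt, h1, le_rfl⟩
    rw [e]
    refine hM.of_randomizedStoppingTime h.adapted h.randomizedStoppingTime (min_le_right _ _) _
      (fun i hi => ?_) x y
    have : (i : ℝ≥0) ≤ j := by exact_mod_cast (Finset.mem_range.1 hi).le
    simp only [hsdef]
    gcongr
  have hstep : ∀ k j, μ (E ∩ {ω | J k ω = j}) * π y ≤
      μ ({ω | X t ω = y} ∩ {ω | J k ω = j}) + μ (B k ∩ {ω | J k ω = j}) := by
    intro k j
    have hlaw : ∀ x, μ (E ∩ {ω | J k ω = j}) * π x =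
        μ (E ∩ {ω | J k ω = j} ∩ {ω | X (T ω).toNNReal ω = x}) := by
      intro x
      have hC : MeasurableSet {c : ℝ≥0 | c ≤ t ∧ ⌈c * (k + 1)⌉₊ = j} :=
        measurableSet_Iic.inter ((Nat.measurable_ceil.comp (measurable_id.mul_const _))
          (measurableSet_singleton j))
      have h3 := h.measure_mem_and_eq hr hC x
      have e : {ω | T ω < ∞ ∧ (T ω).toNNReal ∈ {c : ℝ≥0 | c ≤ t ∧ ⌈c * (k + 1)⌉₊ = j}} =
          E ∩ {ω | J k ω = j} := by
        ext ω
        simp only [mem_inter_iff, mem_ofPred_eq, hEdef, hJdef, ← and_assoc]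
        refine and_congr_left fun _ => ⟨fun h4 => (toNNReal_le_iff h4.1.ne).1 h4.2,
          fun h4 => ⟨lt_of_le_of_lt h4 ENNReal.coe_lt_top, 
            (toNNReal_le_iff (lt_of_le_of_lt h4 ENNReal.coe_lt_top).ne).2 h4⟩⟩
      rw [e] at h3
      rw [← h3, ← e]
      rfl
    have hfib : ∀ A : Set Ω, ∀ Y : Ω → S, Measurable Y →
        ∑ x, μ (A ∩ {ω | Y ω = x}) = μ A := fun A Y hY => by
      rw [measure_eq_tsum_inter_fiber μ (fun x => hY (measurableSet_singleton x)) A, tsum_fintype]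
    -- Stationarity expands `π y` over the state at `T`. Outside `B k` this is the state at the grid
    -- time, where the Markov property applies; on `B k` the kernel is bounded by 1.
    calc μ (E ∩ {ω | J k ω = j}) * π y
        = ∑ x, μ (E ∩ {ω | J k ω = j} ∩ {ω | X (T ω).toNNReal ω = x}) * K (t - s k j) x y := by
          rw [← hπ (t - s k j) y, Finset.mul_sum]
          exact Finset.sum_congr rfl fun x _ => by rw [← hlaw x, mul_assoc]
      _ ≤ ∑ x, (μ (E ∩ {ω | J k ω = j} ∩ {ω | X (s k j) ω = x}) * K (t - s k j) x y +
            μ (B k ∩ {ω | J k ω = j} ∩ {ω | X (T ω).toNNReal ω = x})) := by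
          refine Finset.sum_le_sum fun x _ => ?_
          have hsub : E ∩ {ω | J k ω = j} ∩ {ω | X (T ω).toNNReal ω = x} ⊆
              (E ∩ {ω | J k ω = j} ∩ {ω | X (s k j) ω = x}) ∪
              (B k ∩ {ω | J k ω = j} ∩ {ω | X (T ω).toNNReal ω = x}) := by
            rintro ω ⟨⟨h1, h2⟩, h3⟩
            by_cases h4 : X (s k j) ω = x
            · exact Or.inl ⟨⟨h1, h2⟩, h4⟩
            · refine Or.inr ⟨⟨⟨h1, ?_⟩, h2⟩, h3⟩
              have h2' : J k ω = j := h2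
              have h3' : X (T ω).toNNReal ω = x := h3
              simpa [h2', h3'] using h4
          refine (mul_le_mul_left ((measure_mono hsub).trans (measure_union_le _ _)) _).trans ?_
          rw [add_mul]
          gcongr
          exact mul_le_of_le_one_right (zero_le) (hK _ _ _)
      _ = ∑ x, μ (E ∩ {ω | J k ω = j} ∩ {ω | X t ω = y} ∩ {ω | X (s k j) ω = x}) +
            μ (B k ∩ {ω | J k ω = j}) := by
          rw [Finset.sum_add_distrib, hfib _ _ hXτ]
          congr 1
          refine Finset.sum_congr rfl fun x _ => ?_
          rw [← hI k j x]
          congr 1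
          ext ω
          simp only [mem_inter_iff, mem_ofPred_eq]
          tauto
      _ ≤ _ := by
          rw [hfib _ _ (hXm _)]
          refine add_le_add (measure_mono fun ω hω => ?_) le_rfl
          exact ⟨hω.2, hω.1.2⟩
  have hbound : ∀ k, μ E * π y ≤ μ {ω | X t ω = y} + μ (B k) := by
    intro k
    have hJm : ∀ j, MeasurableSet {ω | J k ω = j} := fun j => hJ k (measurableSet_singleton j)
    rw [measure_eq_tsum_inter_fiber μ hJm E, measure_eq_tsum_inter_fiber μ hJm {ω | X t ω = y},
      measure_eq_tsum_inter_fiber μ hJm (B k), ← ENNReal.tsum_mul_right, ← ENNReal.tsum_add]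
    exact ENNReal.tsum_le_tsum fun j => hstep k j
  -- For each `ω` in `E` the capped rounded times tend to `T ω` from the right, so `ω` lies in only
  -- finitely many `B k`.
  have hlim : Filter.Tendsto (fun k => μ (B k)) Filter.atTop (nhds (μ ∅)) := by
    refine tendsto_measure_of_tendsto_indicator_of_isFiniteMeasure Filter.atTop μ hB ?_
    intro ω
    simp only [hBdef, mem_inter_iff, mem_ofPred_eq, mem_empty_iff_false, iff_false, not_and,
      not_not]
    by_cases hω : ω ∈ E
    · have hle : (T ω).toNNReal ≤ t :=
        (toNNReal_le_iff (lt_of_le_of_lt hω ENNReal.coe_lt_top).ne).2 hω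
      have h1 : Filter.Tendsto (fun k => s k (J k ω)) Filter.atTop
          (nhdsWithin (T ω).toNNReal (Ici (T ω).toNNReal)) := by
        refine tendsto_nhdsWithin_iff.2 ⟨?_, Filter.Eventually.of_forall fun k =>
          le_min (le_roundUp k _) hle⟩
        have h2 := ((tendsto_nhdsWithin_iff.1 (tendsto_roundUp (T ω).toNNReal)).1).min
          (tendsto_const_nhds (x := t))
        rwa [min_eq_left hle] at h2
      filter_upwards [h1.eventually (hr ω _)] with k hk _ using hk
    · exact Filter.Eventually.of_forall fun k h1 => absurd h1 hω
  have := ge_of_tendsto' (tendsto_const_nhds.add hlim) hbound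
  simpa using this

end SeparationBound

/-! ### Criteria for strong stationary and fastest times -/

section FastestCriterion

variable {Ω S : Type*} {m : MeasurableSpace Ω} {μ : Measure Ω} {F : Filtration ℝ≥0 m}
  [MeasurableSpace S] {X : ℝ≥0 → Ω → S} {K : ℝ≥0 → S → S → ℝ≥0∞} {π : PMF S} {T : Ω → ℝ≥0∞}

lemma isStrongStationaryTime_of_measure_lt_top_eq_one [IsProbabilityMeasure μ]
    (hX : ∀ t, Measurable[F t] (X t)) (hT : ∀ t : ℝ≥0, MeasurableSet[F t] {ω | T ω ≤ t})
    (hfin : μ {ω | T ω < ∞} = 1)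
    (hlaw : ∀ (t : ℝ≥0) y, μ {ω | T ω ≤ t ∧ X (T ω).toNNReal ω = y} = μ {ω | T ω ≤ t} * π y)
    (hlaw' : ∀ y, μ {ω | T ω < ∞ ∧ X (T ω).toNNReal ω = y} = π y) :
    IsStrongStationaryTime μ F X π T := by
  have hst : IsRandomizedStoppingTime μ F T :=
    -- An ordinary stopping time needs no extra randomness.
    ⟨⊥, bot_le, indep_bot_left _, fun t => (le_sup_left : (F t : MeasurableSpace Ω) ≤ _) _ (hT t)⟩
  have hE : MeasurableSet {ω | T ω < ∞} := measurableSet_lt hst.measurable measurable_const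
  have hsub : ∀ t : ℝ≥0, {ω | T ω ≤ t} ⊆ {ω | T ω < ∞} := fun t ω hω =>
    lt_of_le_of_lt hω ENNReal.coe_lt_top
  have h1 : ∀ t : ℝ≥0, (μ[|{ω | T ω < ∞}]) {ω | T ω ≤ (t : ℝ≥0∞)} = μ {ω | T ω ≤ (t : ℝ≥0∞)} :=
    fun t => by
      rw [cond_apply hE, hfin, inv_one, one_mul, inter_eq_self_of_subset_right (hsub t)]
  have h2 : ∀ y, (μ[|{ω | T ω < ∞}]) {ω | X (T ω).toNNReal ω = y} = π y := fun y => by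
    rw [cond_apply hE, hfin, inv_one, one_mul, ← hlaw' y]
    rfl
  refine ⟨hX, hst, fun t y => ?_, fun t y => by rw [h2]⟩
  rw [h1, h2, cond_apply hE, hfin, inv_one, one_mul, ← hlaw,
    inter_eq_self_of_subset_right fun ω hω => hsub t hω.1]

/-- By `hsep`, `T` attains the separation bound at `y`. Any competitor satisfies the bound there,
and `π y` cancels. -/
lemma IsStrongStationaryTime.isFastestTimeToStationarity [IsProbabilityMeasure μ] [Fintype S]
    [MeasurableSingletonClass S] (h : IsStrongStationaryTime μ F X π T)
    (hM : HasMarkovProperty μ F X K) (hK : ∀ t x y, K t x y ≤ 1)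
    (hπ : IsStationaryDistribution K π)
    (hr : ∀ ω t, ∀ᶠ s in nhdsWithin t (Ici t), X s ω = X t ω) (y : S) (hy : π y ≠ 0)
    (hsep : ∀ t : ℝ≥0, μ {ω | X t ω = y} = μ {ω | T ω ≤ t} * π y) :
    IsFastestTimeToStationarity μ F X π T := by
  refine ⟨h, fun T' h' t => ?_⟩
  have h1 := h'.measure_le_mul_le hM hK hπ hr t y
  rw [hsep t, ENNReal.mul_le_mul_iff_left hy (π.apply_ne_top y)] at h1
  have e : ∀ R : Ω → ℝ≥0∞, {ω | (t : ℝ≥0∞) < R ω} = {ω | R ω ≤ t}ᶜ := fun R => by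
    ext ω
    simp
  rw [e, e, prob_compl_eq_one_sub (measurableSet_le h.randomizedStoppingTime.measurable
    measurable_const), prob_compl_eq_one_sub (measurableSet_le
    h'.randomizedStoppingTime.measurable measurable_const)]
  exact tsub_le_tsub_left h1 1

end FastestCriterion

/-! ### Poisson processes -/

namespace IsPoissonProcess

/-- Puts finitely many times into a sequence along which independence of increments can be applied.
The point 0 makes each count a sum of increments, and placing `s`, `t` consecutively makes `(s, t]`
a single increment. -/
lemma exists_monotone_seq (G : Finset ℝ≥0) {s t : ℝ≥0} (hst : s ≤ t) (hG : ∀ u ∈ G, u ≤ s) :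
    ∃ (τ : ℕ → ℝ≥0) (k : ℕ), Monotone τ ∧ τ 0 = 0 ∧ τ k = s ∧ τ (k + 1) = t ∧
      ∀ u ∈ G, ∃ i ≤ k, τ i = u := by
  set G' : Finset ℝ≥0 := insert 0 (insert s G) with hG'
  have hne : 0 < G'.card := Finset.card_pos.2 ⟨0, by simp [hG']⟩
  set f := G'.orderEmbOfFin rfl
  have hle : ∀ u ∈ G', u ≤ s := by
    intro u hu
    simp only [hG', Finset.mem_insert] at hu
    rcases hu with rfl | rfl | hu
    · exact zero_le
    · exact le_rfl
    · exact hG u hu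
  have hmem : ∀ i, f i ∈ G' := Finset.orderEmbOfFin_mem G' rfl
  have hsurj : ∀ u ∈ G', ∃ i, f i = u := fun u hu => by
    have : u ∈ Set.range f := by
      rw [Finset.range_orderEmbOfFin]
      exact hu
    exact this
  refine ⟨fun i => if h : i < G'.card then f ⟨i, h⟩ else t, G'.card - 1, ?_, ?_, ?_, ?_, ?_⟩
  · intro i j hij
    by_cases hj : j < G'.card
    · simp only [hj, hij.trans_lt hj, dif_pos]
      exact f.monotone hij
    · simp only [hj, dif_neg, not_false_iff]
      split_ifs with hi
      · exact (hle _ (hmem _)).trans hst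
      · exact le_rfl
  · simp only [hne, dif_pos]
    obtain ⟨i, hi⟩ := hsurj 0 (by simp [hG'])
    have h1 : f ⟨0, hne⟩ ≤ f i := f.monotone (Nat.zero_le _)
    rw [hi] at h1
    exact le_antisymm h1 zero_le
  · have hlt : G'.card - 1 < G'.card := by omega
    simp only [hlt, dif_pos]
    obtain ⟨i, hi⟩ := hsurj s (by simp [hG'])
    refine le_antisymm (hle _ (hmem _)) ?_
    rw [← hi]
    refine f.monotone ?_
    rw [Fin.le_def]
    have := i.2
    simp only
    omega
  · have : ¬ (G'.card - 1 + 1 < G'.card) := by omega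
    simp only [this, dif_neg, not_false_iff]
  · intro u hu
    obtain ⟨i, hi⟩ := hsurj u (by simp [hG', hu])
    exact ⟨i, by have := i.2; omega, by simp [hi]⟩

variable {Ω : Type*} {m : MeasurableSpace Ω} {μ : Measure Ω} {N : ℝ≥0 → Ω → ℕ} {r : ℝ}

/-- The past is a directed supremum over finite sets of times. For each such set the counts are sums
of increments before `s`, which are independent of the increment over `(s, t]`. -/
lemma indep_past_increment [IsProbabilityMeasure μ] (h : IsPoissonProcess N r μ) {s t : ℝ≥0}
    (hst : s ≤ t) :
    Indep (⨆ u : Iic s, MeasurableSpace.comap (N u) ⊤)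
      (MeasurableSpace.comap (fun ω => N t ω - N s ω) ⊤) μ := by
  classical
  have hmeas : ∀ u v, MeasurableSpace.comap (fun ω => N u ω - N v ω) ⊤ ≤ m := fun u v =>
    Measurable.comap_le ((h.measurable u).sub (h.measurable v))
  have e : (⨆ u : Iic s, MeasurableSpace.comap (N u) ⊤) =
      ⨆ G : Finset (Iic s), ⨆ u ∈ G, MeasurableSpace.comap (N u) ⊤ :=
    iSup_eq_iSup_finset _
  rw [e]
  refine indep_iSup_of_directed_le (fun G => ?_) (fun G => iSup₂_le fun u _ =>
    Measurable.comap_le (h.measurable u)) (hmeas t s) ?_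
  · obtain ⟨τ, k, hτ, h0, hk, hk1, hG⟩ := exists_monotone_seq (G.image Subtype.val) hst (by
      intro u hu
      obtain ⟨v, -, rfl⟩ := Finset.mem_image.1 hu
      exact v.2)
    have hi := (iIndepFun_iff_iIndep _ _ _).1 (h.indepIncrements.nat hτ)
    have h1 := indep_iSup_of_disjoint (fun i => hmeas (τ (i + 1)) (τ i)) hi
      (S := Iio k) (T := {k}) (by simp)
    refine indep_of_indep_of_le h1 (iSup₂_le fun u hu => ?_) ?_
    · obtain ⟨i, hik, hiu⟩ := hG u (Finset.mem_image_of_mem _ hu)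
      rw [← hiu]
      have hsum : ∀ j, N (τ j) = fun ω => ∑ l ∈ Finset.range j, (N (τ (l + 1)) ω - N (τ l) ω) := by
        intro j
        funext ω
        induction j with
        | zero => simp [h0, h.zero]
        | succ j ih =>
          rw [Finset.sum_range_succ, ← ih, Nat.add_sub_cancel' (h.monotone ω (hτ j.le_succ))]
      rw [hsum i]
      refine Measurable.comap_le ?_
      refine Finset.measurable_sum _ fun l hl => ?_
      refine Measurable.mono (comap_measurable _) ?_ le_rfl
      have hl' : l ∈ Iio k := lt_of_lt_of_le (Finset.mem_range.1 hl) hik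
      exact le_iSup₂ (f := fun l (_ : l ∈ Iio k) =>
        MeasurableSpace.comap (fun ω => N (τ (l + 1)) ω - N (τ l) ω) ⊤) l hl'
    · simp only [mem_singleton_iff, iSup_iSup_eq_left, hk, hk1]
      exact le_rfl
  · exact directed_of_isDirected_le fun G G' hGG' => biSup_mono hGG'

lemma measure_increment_eq_zero (h : IsPoissonProcess N r μ) (hr : 0 ≤ r) {s t : ℝ≥0}
    (hst : s ≤ t) :
    μ {ω | N t ω - N s ω = 0} = ENNReal.ofReal (Real.exp (-(r * (t - s : ℝ≥0)))) := by
  have h1 := (h.increment_law s t hst).map_eq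
  have h2 : μ {ω | N t ω - N s ω = 0} = μ.map (fun ω => N t ω - N s ω) {0} := by
    have hm : Measurable fun ω => N t ω - N s ω := (h.measurable t).sub (h.measurable s)
    rw [Measure.map_apply hm (measurableSet_singleton 0)]
    rfl
  rw [h2, h1, poissonMeasure_singleton, NNReal.coe_sub hst,
    Real.coe_toNNReal _ (mul_nonneg hr (sub_nonneg.2 (NNReal.coe_le_coe.2 hst)))]
  simp

lemma eventually_eq (h : IsPoissonProcess N r μ) (ω : Ω) (t : ℝ≥0) :
    ∀ᶠ s in nhdsWithin t (Ici t), N s ω = N t ω :=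
  (h.rightContinuous ω t).eventually (p := fun k => k = N t ω) (by simp)

/-- A count of 0 at time `t` persists on some `[t, u)` by right-continuity, which pushes the infimum
above `t`. -/
lemma iInf_le_iff (h : IsPoissonProcess N r μ) (ω : Ω) (t : ℝ≥0) :
    (⨅ (u : ℝ≥0) (_ : 1 ≤ N u ω), (u : ℝ≥0∞)) ≤ t ↔ 1 ≤ N t ω := by
  constructor
  · intro hle
    by_contra hN
    obtain ⟨u, hu, hsub⟩ :=
      (mem_nhdsGE_iff_exists_Ico_subset (a := t)).1 (h.eventually_eq ω t)
    have h1 : (u : ℝ≥0∞) ≤ ⨅ (v : ℝ≥0) (_ : 1 ≤ N v ω), (v : ℝ≥0∞) := by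
      refine le_iInf₂ fun v hv => ?_
      rw [ENNReal.coe_le_coe]
      by_contra hvu
      rcases le_total v t with hvt | hvt
      · exact hN (hv.trans (h.monotone ω hvt))
      · have : N v ω = N t ω := hsub ⟨hvt, not_le.1 hvu⟩
        exact hN (this ▸ hv)
    exact absurd (ENNReal.coe_le_coe.1 (h1.trans hle)) (not_le.2 hu)
  · intro hN
    exact iInf₂_le t hN

end IsPoissonProcess

/-! ### Stationary distributions of the dynamic Erdős–Rényi graph -/

/-- The law of the outcome of an update. -/
noncomputable def updateLaw (n : ℕ) (α β : ℝ) : PMF Bool :=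
  -- The cap at 1 gives a `PMF` for all parameters; it is inactive when the value is a probability,
  -- as `mark_law` ensures under a probability measure.
  PMF.ofFintype (fun b => cond b (min (ENNReal.ofReal (edgeProb n α β)) 1)
    (1 - min (ENNReal.ofReal (edgeProb n α β)) 1)) (by simp)

/-- The product over all vertex pairs of the law of the outcome of an update. -/
noncomputable def graphLaw (n : ℕ) (α β : ℝ) : PMF (GraphState n) :=
  PMF.ofFintype (fun y => ∏ e, updateLaw n α β (y e)) (by
    rw [← Fintype.prod_sum]
    have h : ∑ b, updateLaw n α β b = 1 := by
      rw [← tsum_fintype (L := .unconditional _), PMF.tsum_coe]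
    simp only [h, Finset.prod_const_one])

lemma graphLaw_apply {n : ℕ} {α β : ℝ} (y : GraphState n) :
    graphLaw n α β y = ∏ e, updateLaw n α β (y e) := rfl

lemma two_le_of_vertexPair {n : ℕ} (e : VertexPair n) : 2 ≤ n := by
  obtain ⟨e, he⟩ := e
  induction e using Sym2.ind with
  | _ i j =>
    have hij : i ≠ j := by simpa using he
    have h1 := i.2
    have h2 := j.2
    have h3 : i.1 ≠ j.1 := fun h => hij (Fin.ext h)
    omega

/-- A pair exists only if `n ≥ 2`, and then `0 < p < 1`; for `n = 1` the formula would give `p = 1`.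
-/
lemma updateLaw_ne_zero {n : ℕ} {α β : ℝ} (hα : 0 < α) (hβ : 0 < β) (e : VertexPair n)
    (b : Bool) : updateLaw n α β b ≠ 0 := by
  have hn : (2 : ℝ) ≤ n := by exact_mod_cast two_le_of_vertexPair e
  have h1 : 0 < ((n : ℝ) - 1) * α := mul_pos (by linarith) hα
  have h2 : 0 < edgeProb n α β := div_pos hβ (by linarith)
  have h3 : edgeProb n α β < 1 := by
    rw [edgeProb, div_lt_one (by linarith)]
    linarith
  have h4 : ENNReal.ofReal (edgeProb n α β) < 1 := by
    rw [← ENNReal.ofReal_one]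
    exact (ENNReal.ofReal_lt_ofReal_iff one_pos).2 h3
  cases b
  · simpa [updateLaw, tsub_eq_zero_iff_le] using h4
  · simpa [updateLaw] using h2

lemma updateRate_pos {n : ℕ} (hn : 0 < n) {α β : ℝ} (hα : 0 < α) (hβ : 0 < β) :
    0 < updateRate n α β := by
  have h : (1 : ℝ) ≤ n := by exact_mod_cast hn
  -- For `n = 1` the quotient is 0 by convention, and the rate is `α`.
  have h1 : 0 ≤ β / ((n : ℝ) - 1) := div_nonneg hβ.le (by linarith)
  unfold updateRate
  linarith

/-- The probability that a given vertex pair is not updated during a time `t`. -/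
noncomputable def noUpdateProb (n : ℕ) (α β : ℝ) (t : ℝ≥0) : ℝ≥0∞ :=
  ENNReal.ofReal (Real.exp (-(updateRate n α β * t)))

lemma noUpdateProb_le_one {n : ℕ} {α β : ℝ} (hr : 0 < updateRate n α β) (t : ℝ≥0) :
    noUpdateProb n α β t ≤ 1 := by
  rw [noUpdateProb, ENNReal.ofReal_le_one, Real.exp_le_one_iff]
  have := mul_nonneg hr.le t.2
  simpa using this

lemma one_sub_noUpdateProb {n : ℕ} {α β : ℝ} (t : ℝ≥0) :
    1 - noUpdateProb n α β t = ENNReal.ofReal (1 - Real.exp (-(updateRate n α β * t))) := by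
  rw [ENNReal.ofReal_sub _ (Real.exp_pos _).le, ENNReal.ofReal_one, noUpdateProb]

lemma tendsto_one_sub_noUpdateProb {n : ℕ} {α β : ℝ} (hr : 0 < updateRate n α β) :
    Filter.Tendsto (fun k : ℕ => 1 - noUpdateProb n α β k) Filter.atTop (nhds 1) := by
  have h1 : Filter.Tendsto (fun k : ℕ => Real.exp (-(updateRate n α β * ((k : ℝ≥0) : ℝ))))
      Filter.atTop (nhds 0) := by
    refine Real.tendsto_exp_neg_atTop_nhds_zero.comp ?_
    simpa using (tendsto_natCast_atTop_atTop (R := ℝ)).const_mul_atTop hr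
  have h2 := ENNReal.tendsto_ofReal (tendsto_const_nhds.sub h1 : Filter.Tendsto
    (fun k : ℕ => 1 - Real.exp (-(updateRate n α β * ((k : ℝ≥0) : ℝ)))) Filter.atTop
      (nhds (1 - 0)))
  simpa [one_sub_noUpdateProb] using h2

/-- The transition probability of an edge: with no update it keeps its state, otherwise its state
has the law of an update. -/
noncomputable def edgeKernel (n : ℕ) (α β : ℝ) (t : ℝ≥0) (a b : Bool) : ℝ≥0∞ :=
  (if a = b then noUpdateProb n α β t else 0) + (1 - noUpdateProb n α β t) * updateLaw n α β b

lemma sum_mul_edgeKernel {n : ℕ} {α β : ℝ} (ρ : PMF Bool) (t : ℝ≥0)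
    (b : Bool) : ∑ a, ρ a * edgeKernel n α β t a b =
      ρ b * noUpdateProb n α β t + (1 - noUpdateProb n α β t) * updateLaw n α β b := by
  have h : ∑ a, ρ a = 1 := by rw [← tsum_fintype (L := .unconditional _), PMF.tsum_coe]
  simp only [edgeKernel, mul_add, Finset.sum_add_distrib, ← Finset.sum_mul, h, one_mul]
  simp

lemma sum_updateLaw_mul_edgeKernel {n : ℕ} {α β : ℝ} (hr : 0 < updateRate n α β) (t : ℝ≥0)
    (b : Bool) : ∑ a, updateLaw n α β a * edgeKernel n α β t a b = updateLaw n α β b := by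
  rw [sum_mul_edgeKernel, mul_comm, ← add_mul, add_tsub_cancel_of_le (noUpdateProb_le_one hr t),
    one_mul]

lemma PMF.eq_of_le {S : Type*} {π ρ : PMF S} (h : ∀ y, π y ≤ ρ y) : ρ = π := by
  by_contra hne
  have h1 : ∃ y, π y < ρ y := by
    by_contra hn
    push Not at hn
    exact hne (PMF.ext fun y => le_antisymm (hn y) (h y))
  obtain ⟨y, hy⟩ := h1
  have h2 := ENNReal.tsum_lt_tsum (by rw [π.tsum_coe]; exact ENNReal.one_ne_top) h hy
  rw [π.tsum_coe, ρ.tsum_coe] at h2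
  exact lt_irrefl _ h2

/-- A stationary distribution `π` is unique if the transition function eventually dominates any
multiple `c π` with `c < 1`, uniformly in the initial state. -/
lemma isUniqueStationaryDistribution_of_le {S : Type*} [Fintype S] {K : ℝ≥0 → S → S → ℝ≥0∞}
    {π : PMF S} (hπ : IsStationaryDistribution K π) (c : ℕ → ℝ≥0∞)
    (hc : Filter.Tendsto c Filter.atTop (nhds 1)) (hK : ∀ (k : ℕ) x y, c k * π y ≤ K k x y) :
    IsUniqueStationaryDistribution K π := by
  intro ρ
  refine ⟨fun hρ => PMF.eq_of_le fun y => ?_, fun h => h ▸ hπ⟩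
  have h1 : ∀ k : ℕ, c k * π y ≤ ρ y := fun k => by
    rw [← hρ k y]
    have hs : ∑ x, ρ x = 1 := by rw [← tsum_fintype (L := .unconditional _), PMF.tsum_coe]
    calc c k * π y = ∑ x, ρ x * (c k * π y) := by rw [← Finset.sum_mul, hs, one_mul]
      _ ≤ _ := Finset.sum_le_sum fun x _ => mul_le_mul_right (hK k x y) _
  have h2 := ENNReal.Tendsto.mul_const hc (Or.inr (π.apply_ne_top y))
  rw [one_mul] at h2
  exact le_of_tendsto' h2 h1

namespace DynamicERGraph

variable {Ω : Type*} [m : MeasurableSpace Ω] {n : ℕ} {α β : ℝ} {μ : Measure Ω}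
  (D : DynamicERGraph n α β μ)

/-! ### The σ-algebras of updates and outcomes -/

/-- The σ-algebra generated by the update times of `e`. -/
abbrev updateAlg (e : VertexPair n) : MeasurableSpace Ω :=
  MeasurableSpace.comap (fun ω (t : ℝ≥0) => D.N e t ω) inferInstance

/-- The σ-algebra generated by the outcome of one update. -/
abbrev markAlg (i : VertexPair n × ℕ) : MeasurableSpace Ω :=
  MeasurableSpace.comap (D.mark i.1 i.2) inferInstance

/-- The σ-algebra generated by the updates of `e` until time `s`. -/
abbrev pastAlg (s : ℝ≥0) (e : VertexPair n) : MeasurableSpace Ω :=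
  ⨆ u : Iic s, MeasurableSpace.comap (D.N e u) ⊤

/-- The σ-algebra generated by the number of updates of `e` between `s` and `t`. -/
abbrev incrementAlg (s t : ℝ≥0) (e : VertexPair n) : MeasurableSpace Ω :=
  MeasurableSpace.comap (fun ω => D.N e t ω - D.N e s ω) ⊤

lemma updateAlg_le (e : VertexPair n) : D.updateAlg e ≤ m :=
  Measurable.comap_le (measurable_pi_lambda _ fun t => (D.poisson e).measurable t)

lemma markAlg_le (i : VertexPair n × ℕ) : D.markAlg i ≤ m :=
  Measurable.comap_le (D.measurable_mark i.1 i.2)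

lemma measurable_N_updateAlg (e : VertexPair n) (t : ℝ≥0) :
    Measurable[D.updateAlg e] (D.N e t) :=
  (measurable_pi_apply (X := fun _ : ℝ≥0 => ℕ) t).comp
    (comap_measurable (fun ω (t : ℝ≥0) => D.N e t ω))

lemma pastAlg_le (s : ℝ≥0) (e : VertexPair n) : D.pastAlg s e ≤ D.updateAlg e :=
  iSup_le fun u => (D.measurable_N_updateAlg e u).comap_le

lemma incrementAlg_le (s t : ℝ≥0) (e : VertexPair n) : D.incrementAlg s t e ≤ D.updateAlg e := by
  have h1 := D.measurable_N_updateAlg e t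
  have h2 := D.measurable_N_updateAlg e s
  exact Measurable.comap_le (m₁ := D.updateAlg e) (Measurable.sub (m := D.updateAlg e) h1 h2)

lemma iIndep_updateAlg : iIndep D.updateAlg μ :=
  (iIndepFun_iff_iIndep _ _ _).1 D.indep_N

lemma iIndep_markAlg : iIndep D.markAlg μ :=
  (iIndepFun_iff_iIndep _ _ _).1 D.indep_mark

lemma updateAlg_le_comap : ⨆ e, D.updateAlg e ≤
    MeasurableSpace.comap (fun (ω : Ω) (e : VertexPair n) (t : ℝ≥0) => D.N e t ω)
      inferInstance := by
  refine iSup_le fun e => ?_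
  exact ((measurable_pi_apply e).comp (comap_measurable
    (fun (ω : Ω) (e : VertexPair n) (t : ℝ≥0) => D.N e t ω))).comap_le

lemma markAlg_le_comap : ⨆ i, D.markAlg i ≤
    MeasurableSpace.comap (fun (ω : Ω) (e : VertexPair n) (k : ℕ) => D.mark e k ω)
      inferInstance := by
  refine iSup_le fun i => ?_
  exact ((measurable_pi_apply i.2).comp ((measurable_pi_apply i.1).comp (comap_measurable
    (fun (ω : Ω) (e : VertexPair n) (k : ℕ) => D.mark e k ω)))).comap_le

lemma indep_updateAlg_markAlg : Indep (⨆ e, D.updateAlg e) (⨆ i, D.markAlg i) μ :=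
  indep_of_indep_of_le ((IndepFun_iff_Indep _ _ _).1 D.indep_N_mark) D.updateAlg_le_comap
    D.markAlg_le_comap

lemma indep_init_updates : Indep (MeasurableSpace.comap D.init inferInstance)
    ((⨆ e, D.updateAlg e) ⊔ ⨆ i, D.markAlg i) μ := by
  refine indep_of_indep_of_le_right ((IndepFun_iff_Indep _ _ _).1 D.indep_init)
    (sup_le (D.updateAlg_le_comap.trans ?_) (D.markAlg_le_comap.trans ?_))
  · exact (measurable_fst.comp (comap_measurable
      (fun ω => ((fun (e : VertexPair n) (t : ℝ≥0) => D.N e t ω),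
        (fun (e : VertexPair n) (k : ℕ) => D.mark e k ω))))).comap_le
  · exact (measurable_snd.comp (comap_measurable
      (fun ω => ((fun (e : VertexPair n) (t : ℝ≥0) => D.N e t ω),
        (fun (e : VertexPair n) (k : ℕ) => D.mark e k ω))))).comap_le

/-- The σ-algebra generated by the initial state, the updates until time `s` and, for each `e`, the
outcomes of the first `k e` updates. -/
abbrev historyAlg (s : ℝ≥0) (k : VertexPair n → ℕ) : MeasurableSpace Ω :=
  MeasurableSpace.comap D.init inferInstance ⊔
    ((⨆ e, D.pastAlg s e) ⊔ ⨆ i ∈ {i : VertexPair n × ℕ | i.2 < k i.1}, D.markAlg i)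

/-- The σ-algebra generated by the numbers of updates between `s` and `t` and, for each `e`, the
outcomes of all updates but the first `k e`. -/
abbrev futureAlg (s t : ℝ≥0) (k : VertexPair n → ℕ) : MeasurableSpace Ω :=
  (⨆ e, D.incrementAlg s t e) ⊔ ⨆ i ∈ {i : VertexPair n × ℕ | k i.1 ≤ i.2}, D.markAlg i

/-- Three sources combine: independent increments for each pair, outcomes with disjoint index sets,
and the initial state, which is independent of all updates. -/
lemma indep_historyAlg_futureAlg [IsProbabilityMeasure μ] {s t : ℝ≥0} (hst : s ≤ t)
    (k : VertexPair n → ℕ) : Indep (D.historyAlg s k) (D.futureAlg s t k) μ := by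
  have hU : ⨆ e, D.updateAlg e ≤ m := iSup_le D.updateAlg_le
  have hM : ⨆ i, D.markAlg i ≤ m := iSup_le D.markAlg_le
  have hP : ⨆ e, D.pastAlg s e ≤ ⨆ e, D.updateAlg e := iSup_mono (D.pastAlg_le s)
  have hQ : ⨆ e, D.incrementAlg s t e ≤ ⨆ e, D.updateAlg e := iSup_mono (D.incrementAlg_le s t)
  have hMs : ∀ P : Set (VertexPair n × ℕ), ⨆ i ∈ P, D.markAlg i ≤ ⨆ i, D.markAlg i := fun P =>
    iSup₂_le fun i _ => le_iSup _ i
  have h1 : Indep (⨆ e, D.pastAlg s e) (⨆ e, D.incrementAlg s t e) μ :=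
    indep_iSup_iSup_of_iIndep (fun e => (D.pastAlg_le s e).trans (D.updateAlg_le e))
      (fun e => (D.incrementAlg_le s t e).trans (D.updateAlg_le e))
      (fun e => (D.poisson e).indep_past_increment hst)
      (iIndep_of_iIndep_of_le D.iIndep_updateAlg fun e =>
        sup_le (D.pastAlg_le s e) (D.incrementAlg_le s t e))
  have h2 : Indep (⨆ i ∈ {i : VertexPair n × ℕ | i.2 < k i.1}, D.markAlg i)
      (⨆ i ∈ {i : VertexPair n × ℕ | k i.1 ≤ i.2}, D.markAlg i) μ := by
    refine indep_iSup_of_disjoint D.markAlg_le D.iIndep_markAlg ?_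
    rw [Set.disjoint_left]
    exact fun i (hi : i.2 < k i.1) (hi' : k i.1 ≤ i.2) => absurd hi (not_lt.2 hi')
  have h3 := indep_sup_sup (hP.trans hU) (hQ.trans hU) ((hMs _).trans hM) ((hMs _).trans hM) h1 h2
    (indep_of_indep_of_le D.indep_updateAlg_markAlg (sup_le hP hQ) (sup_le (hMs _) (hMs _)))
  have h4 : (⨆ e, D.pastAlg s e) ⊔ (⨆ i ∈ {i : VertexPair n × ℕ | i.2 < k i.1}, D.markAlg i) ≤
      (⨆ e, D.updateAlg e) ⊔ ⨆ i, D.markAlg i := sup_le_sup hP (hMs _)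
  have h5 : D.futureAlg s t k ≤ (⨆ e, D.updateAlg e) ⊔ ⨆ i, D.markAlg i := sup_le_sup hQ (hMs _)
  -- The initial state joins the history only; its partner on the future side is `⊥`.
  have h6 := indep_sup_sup D.measurable_init.comap_le bot_le (h4.trans (sup_le hU hM))
    (h5.trans (sup_le hU hM)) (indep_bot_right _) h3
    (indep_of_indep_of_le D.indep_init_updates (sup_le le_rfl bot_le) (sup_le h4 h5))
  rw [bot_sup_eq] at h6
  exact h6

/-! ### Outcomes at random updates -/

lemma measure_mark_eq [IsProbabilityMeasure μ] (e : VertexPair n) (k : ℕ) (b : Bool) :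
    μ {ω | D.mark e k ω = b} = updateLaw n α β b := by
  have h1 : μ {ω | D.mark e k ω = true} = min (ENNReal.ofReal (edgeProb n α β)) 1 := by
    rw [← D.mark_law e k, min_eq_left prob_le_one]
  cases b
  · have h2 : {ω | D.mark e k ω = false} = {ω | D.mark e k ω = true}ᶜ := by
      ext ω
      simp
    have h3 : MeasurableSet {ω | D.mark e k ω = true} :=
      D.measurable_mark e k (measurableSet_singleton true)
    rw [h2, prob_compl_eq_one_sub h3, h1]
    rfl
  · exact h1

/-- The indices `κ` are random but determined by the Poisson processes. On each of the countably
many fibres of `κ` they are constant, and the outcomes involved are independent of that fibre and of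
`A`. -/
lemma measure_inter_marks_eq [IsProbabilityMeasure μ] {A : Set Ω}
    (hA : MeasurableSet[⨆ e, D.updateAlg e] A) {κ : VertexPair n → Ω → ℕ}
    (hκ : ∀ e, Measurable[⨆ e, D.updateAlg e] (κ e)) (S : Finset (VertexPair n))
    (y : VertexPair n → Bool) :
    μ (A ∩ {ω | ∀ e ∈ S, D.mark e (κ e ω) ω = y e}) = μ A * ∏ e ∈ S, updateLaw n α β (y e) := by
  have hJ : ∀ k : VertexPair n → ℕ, MeasurableSet[⨆ e, D.updateAlg e] {ω | (fun e => κ e ω) = k} :=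
    fun k => (@measurable_pi_lambda _ _ _ (⨆ e, D.updateAlg e) _ _ hκ) (measurableSet_singleton k)
  have hJm : ∀ k : VertexPair n → ℕ, MeasurableSet {ω | (fun e => κ e ω) = k} := fun k =>
    iSup_le D.updateAlg_le _ (hJ k)
  rw [measure_eq_tsum_inter_fiber μ hJm, measure_eq_tsum_inter_fiber μ hJm A,
    ← ENNReal.tsum_mul_right]
  refine tsum_congr fun k => ?_
  have e1 : A ∩ {ω | ∀ e ∈ S, D.mark e (κ e ω) ω = y e} ∩ {ω | (fun e => κ e ω) = k} =
      A ∩ {ω | (fun e => κ e ω) = k} ∩ ⋂ e ∈ S, {ω | D.mark e (k e) ω = y e} := by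
    ext ω
    simp only [mem_inter_iff, mem_ofPred_eq, mem_iInter]
    constructor
    · rintro ⟨⟨h1, h2⟩, rfl⟩
      exact ⟨⟨h1, rfl⟩, h2⟩
    · rintro ⟨⟨h1, rfl⟩, h2⟩
      exact ⟨⟨h1, h2⟩, rfl⟩
  have hmk : ∀ e, MeasurableSet[D.markAlg (e, k e)] {ω | D.mark e (k e) ω = y e} := fun e =>
    ⟨{y e}, measurableSet_singleton _, rfl⟩
  have hind := (Indep_iff _ _ _).1 D.indep_updateAlg_markAlg
  rw [e1, hind _ _ (MeasurableSet.inter (m := ⨆ e, D.updateAlg e) hA (hJ k))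
    (Finset.measurableSet_biInter (m := ⨆ i, D.markAlg i) S fun e _ =>
      le_iSup D.markAlg (e, k e) _ (hmk e))]
  congr 1
  have hii := (D.iIndep_markAlg.precomp (g := fun e : VertexPair n => (e, k e))
    fun e e' h => congrArg Prod.fst h)
  rw [hii.meas_biInter fun e _ => hmk e]
  exact Finset.prod_congr rfl fun e _ => D.measure_mark_eq e (k e) (y e)

end DynamicERGraph

namespace DynamicERGraph

variable {Ω : Type*} [m : MeasurableSpace Ω] {n : ℕ} {α β : ℝ} {μ : Measure Ω}
  (D : DynamicERGraph n α β μ)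

/-! ### Transition functions -/

/-- The state at time `t` of the pair `e` when its state at time `s` is `a` and it has been updated
`k e` times until then. -/
def futureEdge (s : ℝ≥0) (k : VertexPair n → ℕ) (a : Bool) (e : VertexPair n) (t : ℝ≥0) (ω : Ω) :
    Bool :=
  match D.N e t ω - D.N e s ω with
  | 0 => a
  | j + 1 => D.mark e (k e + j) ω

lemma edgeFrom_eq_futureEdge (a : Bool) (e : VertexPair n) (t : ℝ≥0) (ω : Ω) :
    D.edgeFrom a e t ω = D.futureEdge 0 0 a e t ω := by
  simp only [edgeFrom, futureEdge, (D.poisson e).zero, Nat.sub_zero, Pi.zero_apply, zero_add]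

/-- The pathwise form of the Markov property: after `s`, only the state at `s` and later updates
matter. -/
lemma edge_eq_futureEdge {s t : ℝ≥0} (hst : s ≤ t) (e : VertexPair n) (ω : Ω) :
    D.edge e t ω = D.futureEdge s (fun e => D.N e s ω) (D.edge e s ω) e t ω := by
  have h := (D.poisson e).monotone ω hst
  simp only at h
  obtain ⟨j, hj⟩ := Nat.exists_eq_add_of_le h
  simp only [edge, edgeFrom, futureEdge, hj, Nat.add_sub_cancel_left]
  cases j
  · rfl
  · rfl

/-- `H` is left free because it serves as the σ-algebra of a single pair, as that of the future, and
as the ambient one. -/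
lemma measurableSet_futureEdge {Ω : Type*} {H : MeasurableSpace Ω} [m : MeasurableSpace Ω]
    {μ : Measure Ω} (D : DynamicERGraph n α β μ) {s t : ℝ≥0} {k : VertexPair n → ℕ}
    {e : VertexPair n} (hN : D.incrementAlg s t e ≤ H) (hM : ∀ j, D.markAlg (e, k e + j) ≤ H)
    (a b : Bool) : MeasurableSet[H] {ω | D.futureEdge s k a e t ω = b} := by
  have h1 : ∀ j, MeasurableSet[H] {ω | D.N e t ω - D.N e s ω = j} := fun j =>
    hN _ ⟨{j}, trivial, rfl⟩
  have h2 : ∀ j, MeasurableSet[H] {ω | D.mark e (k e + j) ω = b} := fun j =>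
    hM j _ ⟨{b}, measurableSet_singleton _, rfl⟩
  have e1 : {ω | D.futureEdge s k a e t ω = b} =
      ({ω | D.N e t ω - D.N e s ω = 0} ∩ {_ω | a = b}) ∪
        ⋃ j, ({ω | D.N e t ω - D.N e s ω = j + 1} ∩ {ω | D.mark e (k e + j) ω = b}) := by
    ext ω
    simp only [futureEdge, mem_union, mem_inter_iff, mem_iUnion, mem_ofPred_eq]
    cases D.N e t ω - D.N e s ω <;> simp
  rw [e1]
  exact MeasurableSet.union (m := H) (MeasurableSet.inter (m := H) (h1 0)
    (@MeasurableSet.const _ H _)) (MeasurableSet.iUnion (m := H) fun j =>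
      MeasurableSet.inter (m := H) (h1 _) (h2 j))

lemma measure_futureEdge [IsProbabilityMeasure μ] (hr : 0 < updateRate n α β) {s t : ℝ≥0}
    (hst : s ≤ t) (k : VertexPair n → ℕ) (e : VertexPair n) (a b : Bool) :
    μ {ω | D.futureEdge s k a e t ω = b} = edgeKernel n α β (t - s) a b := by
  have hz : μ {ω | D.N e t ω - D.N e s ω = 0} = noUpdateProb n α β (t - s) :=
    (D.poisson e).measure_increment_eq_zero hr.le hst
  have hUe : ∀ e, D.updateAlg e ≤ ⨆ e, D.updateAlg e := le_iSup D.updateAlg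
  have hinc : ∀ e, Measurable[⨆ e, D.updateAlg e] fun ω => D.N e t ω - D.N e s ω := fun e =>
    Measurable.sub (m := ⨆ e, D.updateAlg e)
      ((D.measurable_N_updateAlg e t).mono (hUe e) le_rfl)
      ((D.measurable_N_updateAlg e s).mono (hUe e) le_rfl)
  have h0 : MeasurableSet[⨆ e, D.updateAlg e] {ω | D.N e t ω - D.N e s ω = 0} :=
    hinc e (measurableSet_singleton 0)
  have h0' : MeasurableSet {ω | D.N e t ω - D.N e s ω = 0} := iSup_le D.updateAlg_le _ h0
  rw [← measure_inter_add_sdiff _ h0', edgeKernel]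
  congr 1
  · split_ifs with hab
    · rw [← hz]
      congr 1
      ext ω
      simp only [mem_inter_iff, mem_ofPred_eq, and_iff_right_iff_imp]
      intro h
      simp only [futureEdge, h, hab]
    · have : {ω | D.futureEdge s k a e t ω = b} ∩ {ω | D.N e t ω - D.N e s ω = 0} = ∅ := by
        ext ω
        simp only [mem_inter_iff, mem_ofPred_eq, mem_empty_iff_false, iff_false, not_and]
        intro h h'
        simp only [futureEdge, h'] at h
        exact hab h
      rw [this, measure_empty]
  -- `κ` is the index of the last update in `(s, t]`, counted from 0; its value when there is none
  -- is irrelevant on the complement of the no-update event.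
  · have h1 := D.measure_inter_marks_eq (MeasurableSet.compl (m := ⨆ e, D.updateAlg e) h0)
      (κ := fun e ω => k e + (D.N e t ω - D.N e s ω - 1))
      (fun e => (measurable_from_top (f := fun j => k e + (j - 1))).comp (hinc e)) {e} (fun _ => b)
    rw [prob_compl_eq_one_sub h0', hz, Finset.prod_singleton] at h1
    rw [← h1]
    congr 1
    ext ω
    simp only [futureEdge, mem_sdiff, mem_inter_iff, mem_compl_iff, mem_ofPred_eq,
      Finset.mem_singleton, forall_eq]
    rw [and_comm]
    refine and_congr_right fun h => ?_
    obtain ⟨j, hj⟩ := Nat.exists_eq_succ_of_ne_zero h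
    simp [hj]

lemma measure_forall_futureEdge [IsProbabilityMeasure μ] (hr : 0 < updateRate n α β) {s t : ℝ≥0}
    (hst : s ≤ t) (k : VertexPair n → ℕ) (x y : GraphState n) :
    μ {ω | ∀ e, D.futureEdge s k (x e) e t ω = y e} =
      ∏ e, edgeKernel n α β (t - s) (x e) (y e) := by
  have hM : ∀ e, ⨆ j, D.markAlg (e, j) ≤ ⨆ i, D.markAlg i := fun e =>
    iSup_le fun j => le_iSup D.markAlg (e, j)
  have hI : ∀ e, D.incrementAlg s t e ≤ m := fun e =>
    (D.incrementAlg_le s t e).trans (D.updateAlg_le e)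
  have hind : iIndep (fun e => D.incrementAlg s t e ⊔ ⨆ j, D.markAlg (e, j)) μ :=
    iIndep_sup hI (fun e => (hM e).trans (iSup_le D.markAlg_le))
      (iIndep_of_iIndep_of_le D.iIndep_updateAlg (D.incrementAlg_le s t))
      (iIndep_iSup_prod D.markAlg_le D.iIndep_markAlg)
      (indep_of_indep_of_le D.indep_updateAlg_markAlg (iSup_mono (D.incrementAlg_le s t))
        (iSup_le hM))
  have e1 : {ω | ∀ e, D.futureEdge s k (x e) e t ω = y e} =
      ⋂ e, {ω | D.futureEdge s k (x e) e t ω = y e} := by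
    ext ω
    simp
  rw [e1, hind.meas_iInter fun e => D.measurableSet_futureEdge le_sup_left
    (fun j => le_trans (le_iSup (fun j => D.markAlg (e, j)) (k e + j)) le_sup_right) _ _]
  exact Finset.prod_congr rfl fun e _ => D.measure_futureEdge hr hst k e (x e) (y e)

lemma edgeTransition_eq [IsProbabilityMeasure μ] (hr : 0 < updateRate n α β) (e : VertexPair n)
    (t : ℝ≥0) (a b : Bool) : D.edgeTransition e t a b = edgeKernel n α β t a b := by
  simp only [edgeTransition, edgeFrom_eq_futureEdge]
  rw [D.measure_futureEdge hr zero_le, tsub_zero]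

lemma graphTransition_eq [IsProbabilityMeasure μ] (hr : 0 < updateRate n α β) (t : ℝ≥0)
    (x y : GraphState n) : D.graphTransition t x y = ∏ e, edgeKernel n α β t (x e) (y e) := by
  simp only [graphTransition, edgeFrom_eq_futureEdge, funext_iff]
  rw [D.measure_forall_futureEdge hr zero_le, tsub_zero]

/-! ### Adaptedness and the Markov property -/

lemma measurableSet_filtration_lt (e : VertexPair n) (k : ℕ) {s t : ℝ≥0} (hst : s ≤ t) :
    MeasurableSet[D.filtration t] {ω | k < D.N e s ω} :=
  MeasurableSpace.measurableSet_generateFrom (Or.inr ⟨e, s, k, hst, Or.inl rfl⟩)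

lemma measurableSet_filtration_mark (e : VertexPair n) (k : ℕ) {s t : ℝ≥0} (hst : s ≤ t) :
    MeasurableSet[D.filtration t] {ω | k < D.N e s ω ∧ D.mark e k ω = true} :=
  MeasurableSpace.measurableSet_generateFrom (Or.inr ⟨e, s, k, hst, Or.inr rfl⟩)

lemma measurable_edge (e : VertexPair n) (t : ℝ≥0) : Measurable[D.filtration t] (D.edge e t) := by
  refine @measurable_to_bool _ (D.filtration t) _ ?_
  -- The filtration reveals an outcome only once its update has occurred, so the last update is
  -- written as one that has occurred while the next has not.
  have e1 : D.edge e t ⁻¹' {true} = (D.init ⁻¹' {x | x e = true} \ {ω | 0 < D.N e t ω}) ∪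
      ⋃ k, ({ω | k < D.N e t ω ∧ D.mark e k ω = true} \ {ω | k + 1 < D.N e t ω}) := by
    ext ω
    simp only [edge, edgeFrom, mem_preimage, mem_singleton_iff, mem_union, mem_sdiff, mem_iUnion,
      mem_ofPred_eq]
    cases h : D.N e t ω with
    | zero => simp
    | succ j =>
      simp only [Nat.succ_pos, not_true_eq_false, and_false, false_or]
      constructor
      · exact fun hm => ⟨j, ⟨j.lt_succ_self, hm⟩, lt_irrefl _⟩
      · rintro ⟨i, ⟨h1, h2⟩, h3⟩
        have : i = j := by omega
        exact this ▸ h2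
  rw [e1]
  refine MeasurableSet.union (m := D.filtration t) (MeasurableSet.diff (m := D.filtration t)
    (MeasurableSpace.measurableSet_generateFrom (Or.inl ⟨_, rfl⟩))
    (D.measurableSet_filtration_lt e 0 le_rfl)) (MeasurableSet.iUnion (m := D.filtration t)
      fun k => MeasurableSet.diff (m := D.filtration t) (D.measurableSet_filtration_mark e k le_rfl)
        (D.measurableSet_filtration_lt e (k + 1) le_rfl))

lemma measurable_graph (t : ℝ≥0) : Measurable[D.filtration t] (D.graph t) :=
  @measurable_pi_lambda _ _ _ (D.filtration t) _ _ fun e => D.measurable_edge e t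

/-- Once the counts at time `s` are fixed to be `k`, an event observing an outcome of index at least
`k e` by time `s` has empty trace, so the generators involve only outcomes available to the history.
-/
lemma measurableSet_historyAlg_inter {s : ℝ≥0} {A : Set Ω} (hA : MeasurableSet[D.filtration s] A)
    (k : VertexPair n → ℕ) :
    MeasurableSet[D.historyAlg s k] (A ∩ {ω | (fun e => D.N e s ω) = k}) := by
  have hN : ∀ e, ∀ u ≤ s, Measurable[D.historyAlg s k] (D.N e u) := fun e u hu => by
    have h1 : MeasurableSpace.comap (D.N e u) ⊤ ≤ D.historyAlg s k :=
      le_trans (le_trans (le_iSup (fun u : Iic s => MeasurableSpace.comap (D.N e u) ⊤) ⟨u, hu⟩)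
        (le_iSup (D.pastAlg s) e)) (le_trans le_sup_left le_sup_right)
    exact (comap_measurable _).mono h1 le_rfl
  have hE : MeasurableSet[D.historyAlg s k] {ω | (fun e => D.N e s ω) = k} :=
    (@measurable_pi_lambda _ _ _ (D.historyAlg s k) _ _ fun e => hN e s le_rfl)
      (measurableSet_singleton k)
  refine MeasurableSpace.generateFrom_induction (D.basicEvents s)
    (fun A _ => MeasurableSet[D.historyAlg s k] (A ∩ {ω | (fun e => D.N e s ω) = k}))
    ?_ ?_ ?_ ?_ A hA
  · rintro A (⟨B, rfl⟩ | ⟨e, u, j, hu, hA⟩) -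
    · refine MeasurableSet.inter (m := D.historyAlg s k) ?_ hE
      exact (le_sup_left : MeasurableSpace.comap D.init inferInstance ≤ D.historyAlg s k) _
        ⟨B, B.toFinite.measurableSet, rfl⟩
    · have h1 : MeasurableSet[D.historyAlg s k] {ω | j < D.N e u ω} :=
        hN e u hu (measurableSet_Ioi (a := j))
      rcases hA with rfl | rfl
      · exact MeasurableSet.inter (m := D.historyAlg s k) h1 hE
      · by_cases hj : j < k e
        · have h2 : MeasurableSet[D.historyAlg s k] {ω | D.mark e j ω = true} := by
            have h3 : D.markAlg (e, j) ≤ D.historyAlg s k :=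
              le_trans (le_iSup₂ (f := fun i (_ : i ∈ {i : VertexPair n × ℕ | i.2 < k i.1}) =>
                D.markAlg i) (e, j) hj) (le_trans le_sup_right le_sup_right)
            exact h3 _ ⟨{true}, measurableSet_singleton _, rfl⟩
          exact MeasurableSet.inter (m := D.historyAlg s k)
            (MeasurableSet.inter (m := D.historyAlg s k) h1 h2) hE
        · have h2 : {ω | j < D.N e u ω ∧ D.mark e j ω = true} ∩ {ω | (fun e => D.N e s ω) = k} =
              ∅ := by
            ext ω
            simp only [mem_inter_iff, mem_ofPred_eq, mem_empty_iff_false, iff_false, not_and]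
            rintro ⟨h3, -⟩ rfl
            exact hj (lt_of_lt_of_le h3 ((D.poisson e).monotone ω hu))
          rw [h2]
          exact @MeasurableSet.empty _ (D.historyAlg s k)
  · rw [empty_inter]
    exact @MeasurableSet.empty _ (D.historyAlg s k)
  · intro B _ hB
    have h1 : Bᶜ ∩ {ω | (fun e => D.N e s ω) = k} = {ω | (fun e => D.N e s ω) = k} \
        (B ∩ {ω | (fun e => D.N e s ω) = k}) := by
      ext ω
      simp only [mem_inter_iff, mem_compl_iff, mem_sdiff]
      tauto
    rw [h1]
    exact MeasurableSet.diff (m := D.historyAlg s k) hE hB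
  · intro B _ hB
    rw [iUnion_inter]
    exact MeasurableSet.iUnion (m := D.historyAlg s k) hB

lemma hasMarkovProperty_graph [IsProbabilityMeasure μ] (hr : 0 < updateRate n α β) :
    HasMarkovProperty μ D.filtration D.graph D.graphTransition := by
  intro s t hst A hA x y
  have hJ : ∀ k : VertexPair n → ℕ, MeasurableSet {ω | (fun e => D.N e s ω) = k} := fun k =>
    (measurable_pi_lambda _ fun e => (D.poisson e).measurable s) (measurableSet_singleton k)
  rw [measure_eq_tsum_inter_fiber μ hJ, measure_eq_tsum_inter_fiber μ hJ (A ∩ _),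
    ← ENNReal.tsum_mul_right]
  refine tsum_congr fun k => ?_
  have hx : MeasurableSet[D.filtration s] {ω | D.graph s ω = x} :=
    D.measurable_graph s (measurableSet_singleton x)
  have e1 : A ∩ {ω | D.graph s ω = x ∧ D.graph t ω = y} ∩ {ω | (fun e => D.N e s ω) = k} =
      A ∩ {ω | D.graph s ω = x} ∩ {ω | (fun e => D.N e s ω) = k} ∩
        {ω | ∀ e, D.futureEdge s k (x e) e t ω = y e} := by
    ext ω
    simp only [mem_inter_iff, mem_ofPred_eq]
    have h : ∀ (_ : D.graph s ω = x) (_ : (fun e => D.N e s ω) = k),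
        D.graph t ω = y ↔ ∀ e, D.futureEdge s k (x e) e t ω = y e := by
      rintro rfl rfl
      simp only [funext_iff, graph, D.edge_eq_futureEdge hst]
    tauto
  have hfut : MeasurableSet[D.futureAlg s t k]
      {ω | ∀ e, D.futureEdge s k (x e) e t ω = y e} := by
    rw [show {ω | ∀ e, D.futureEdge s k (x e) e t ω = y e} =
      ⋂ e, {ω | D.futureEdge s k (x e) e t ω = y e} by ext ω; simp]
    refine MeasurableSet.iInter (m := D.futureAlg s t k) fun e => D.measurableSet_futureEdge
      (le_trans (le_iSup (D.incrementAlg s t) e) le_sup_left) (fun j => ?_) _ _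
    exact le_trans (le_iSup₂ (f := fun i (_ : i ∈ {i : VertexPair n × ℕ | k i.1 ≤ i.2}) =>
      D.markAlg i) (e, k e + j) (Nat.le_add_right _ _)) le_sup_right
  rw [e1, (Indep_iff _ _ _).1 (D.indep_historyAlg_futureAlg hst k) _ _
    (D.measurableSet_historyAlg_inter (MeasurableSet.inter (m := D.filtration s) hA hx) k) hfut,
    D.measure_forall_futureEdge hr hst, D.graphTransition_eq hr]

/-- The filtration contains all pairs, so the property is deduced from the graph: split over the
full states at `s` and `t`, and recover the edge transition as a marginal of the graph transition.
-/
lemma hasMarkovProperty_edge [IsProbabilityMeasure μ] (hr : 0 < updateRate n α β)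
    (e : VertexPair n) :
    HasMarkovProperty μ D.filtration (D.edge e) (D.edgeTransition e) := by
  intro s t hst A hA a b
  have hG : ∀ t x, MeasurableSet {ω | D.graph t ω = x} := fun t x =>
    D.filtration.le t _ (D.measurable_graph t (measurableSet_singleton x))
  rw [measure_eq_tsum_inter_fiber μ (hG s), measure_eq_tsum_inter_fiber μ (hG s) (A ∩ _),
    ← ENNReal.tsum_mul_right]
  refine tsum_congr fun x => ?_
  by_cases hx : x e = a
  · have e1 : A ∩ {ω | D.edge e s ω = a} ∩ {ω | D.graph s ω = x} = A ∩ {ω | D.graph s ω = x} := by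
      ext ω
      simp only [mem_inter_iff, mem_ofPred_eq]
      have : D.graph s ω = x → D.edge e s ω = a := fun h => (congrFun h e).trans hx
      tauto
    have e2 : ∀ y, A ∩ {ω | D.edge e s ω = a ∧ D.edge e t ω = b} ∩ {ω | D.graph s ω = x} ∩
        {ω | D.graph t ω = y} =
        if y e = b then A ∩ {ω | D.graph s ω = x ∧ D.graph t ω = y} else ∅ := by
      intro y
      ext ω
      have h1 : D.graph s ω = x → D.edge e s ω = a := fun h => (congrFun h e).trans hx
      have h2 : D.graph t ω = y → D.edge e t ω = y e := fun h => congrFun h e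
      split_ifs with hy
      · simp only [mem_inter_iff, mem_ofPred_eq]
        rw [hy] at h2
        tauto
      · simp only [mem_inter_iff, mem_ofPred_eq, mem_empty_iff_false, iff_false]
        rintro ⟨⟨⟨-, -, h3⟩, -⟩, h4⟩
        exact hy ((h2 h4).symm.trans h3)
    have e3 : ∀ y, {ω | D.edgeFrom a e (t - s) ω = b} ∩
        {ω | (fun e => D.edgeFrom (x e) e (t - s) ω) = y} =
        if y e = b then {ω | (fun e => D.edgeFrom (x e) e (t - s) ω) = y} else ∅ := by
      intro y
      ext ω
      have h2 : (fun e => D.edgeFrom (x e) e (t - s) ω) = y → D.edgeFrom a e (t - s) ω = y e :=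
        fun h => hx ▸ congrFun h e
      split_ifs with hy
      · simp only [mem_inter_iff, mem_ofPred_eq]
        rw [hy] at h2
        tauto
      · simp only [mem_inter_iff, mem_ofPred_eq, mem_empty_iff_false, iff_false]
        rintro ⟨h3, h4⟩
        exact hy ((h2 h4).symm.trans h3)
    have hF : ∀ y, MeasurableSet {ω | (fun e => D.edgeFrom (x e) e (t - s) ω) = y} := by
      intro y
      rw [show {ω | (fun e => D.edgeFrom (x e) e (t - s) ω) = y} =
        ⋂ e, {ω | D.futureEdge 0 0 (x e) e (t - s) ω = y e} by
          ext ω; simp [funext_iff, edgeFrom_eq_futureEdge]]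
      exact MeasurableSet.iInter fun e => D.measurableSet_futureEdge
        ((D.incrementAlg_le _ _ e).trans (D.updateAlg_le e)) (fun j => D.markAlg_le _) _ _
    rw [e1, measure_eq_tsum_inter_fiber μ (hG t), edgeTransition,
      measure_eq_tsum_inter_fiber μ hF {ω | D.edgeFrom a e (t - s) ω = b}, ← ENNReal.tsum_mul_left]
    refine tsum_congr fun y => ?_
    rw [e2, e3]
    split_ifs with hy
    · exact D.hasMarkovProperty_graph hr hst A hA x y
    · simp
  · have e1 : ∀ B ⊆ {ω | D.edge e s ω = a}, A ∩ B ∩ {ω | D.graph s ω = x} = ∅ := by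
      intro B hB
      ext ω
      simp only [mem_inter_iff, mem_ofPred_eq, mem_empty_iff_false, iff_false, not_and]
      rintro ⟨-, h1⟩ h2
      exact hx ((congrFun h2 e).symm.trans (hB h1))
    rw [e1 _ (fun ω hω => hω.1), e1 _ le_rfl, measure_empty, zero_mul]

end DynamicERGraph

namespace DynamicERGraph

variable {Ω : Type*} [m : MeasurableSpace Ω] {n : ℕ} {α β : ℝ} {μ : Measure Ω}
  (D : DynamicERGraph n α β μ)

/-! ### The first update times -/

lemma firstUpdate_le_iff (e : VertexPair n) (t : ℝ≥0) (ω : Ω) :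
    D.firstUpdate e ω ≤ t ↔ 1 ≤ D.N e t ω :=
  (D.poisson e).iInf_le_iff ω t

lemma maxFirstUpdate_le_iff (t : ℝ≥0) (ω : Ω) :
    D.maxFirstUpdate ω ≤ t ↔ ∀ e, 1 ≤ D.N e t ω := by
  simp only [maxFirstUpdate, iSup_le_iff, firstUpdate_le_iff]

lemma measure_one_le_N [IsProbabilityMeasure μ] (hr : 0 < updateRate n α β) (e : VertexPair n)
    (t : ℝ≥0) : μ {ω | 1 ≤ D.N e t ω} = 1 - noUpdateProb n α β t := by
  have h1 := (D.poisson e).measure_increment_eq_zero hr.le (zero_le : 0 ≤ t)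
  simp only [(D.poisson e).zero, tsub_zero] at h1
  have h2 : {ω | 1 ≤ D.N e t ω} = {ω | D.N e t ω = 0}ᶜ := by
    ext ω
    simp [Nat.one_le_iff_ne_zero]
  have h3 : MeasurableSet {ω | D.N e t ω = 0} :=
    (D.poisson e).measurable t (measurableSet_singleton 0)
  rw [h2, prob_compl_eq_one_sub h3, h1, noUpdateProb]

lemma measure_firstUpdate_le [IsProbabilityMeasure μ] (hr : 0 < updateRate n α β)
    (e : VertexPair n) (t : ℝ≥0) :
    μ {ω | D.firstUpdate e ω ≤ t} = 1 - noUpdateProb n α β t := by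
  simp only [firstUpdate_le_iff]
  exact D.measure_one_le_N hr e t

lemma measure_maxFirstUpdate_le [IsProbabilityMeasure μ] (hr : 0 < updateRate n α β) (t : ℝ≥0) :
    μ {ω | D.maxFirstUpdate ω ≤ t} =
      (1 - noUpdateProb n α β t) ^ Fintype.card (VertexPair n) := by
  simp only [maxFirstUpdate_le_iff]
  have hN : ∀ e, MeasurableSet[D.updateAlg e] {ω | 1 ≤ D.N e t ω} := fun e =>
    D.measurable_N_updateAlg e t (measurableSet_Ici (a := 1))
  rw [show {ω | ∀ e, 1 ≤ D.N e t ω} = ⋂ e, {ω | 1 ≤ D.N e t ω} by ext ω; simp,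
    D.iIndep_updateAlg.meas_iInter hN]
  simp only [D.measure_one_le_N hr, Finset.prod_const, Finset.card_univ]

lemma measure_lt_top_eq_one [IsProbabilityMeasure μ] {T : Ω → ℝ≥0∞} {c : ℕ → ℝ≥0∞}
    (hc : Filter.Tendsto c Filter.atTop (nhds 1))
    (h : ∀ k : ℕ, μ {ω | T ω ≤ (k : ℝ≥0)} = c k) : μ {ω | T ω < ∞} = 1 := by
  refine le_antisymm prob_le_one (le_of_tendsto' hc fun k => ?_)
  rw [← h k]
  exact measure_mono fun ω hω => lt_of_le_of_lt hω ENNReal.coe_lt_top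

lemma measure_inter_edges_eq [IsProbabilityMeasure μ] {A : Set Ω}
    (hA : MeasurableSet[⨆ e, D.updateAlg e] A) {T : Ω → ℝ≥0∞}
    (hT : Measurable[⨆ e, D.updateAlg e] T) (S : Finset (VertexPair n))
    (h : ∀ ω ∈ A, ∀ e ∈ S, 1 ≤ D.N e (T ω).toNNReal ω) (y : VertexPair n → Bool) :
    μ (A ∩ {ω | ∀ e ∈ S, D.edge e (T ω).toNNReal ω = y e}) =
      μ A * ∏ e ∈ S, updateLaw n α β (y e) := by
  have hN : ∀ e, Measurable[⨆ e, D.updateAlg e] fun ω => D.N e (T ω).toNNReal ω := fun e =>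
    measurable_eval_randomTime (m := ⨆ e, D.updateAlg e)
      (fun t => (D.measurable_N_updateAlg e t).mono (le_iSup D.updateAlg e) le_rfl)
      (D.poisson e).eventually_eq (@Measurable.ennreal_toNNReal _ (⨆ e, D.updateAlg e) _ hT)
  -- After `N` updates the last one has index `N - 1`; by `h` the subtraction is genuine on `A`.
  rw [← D.measure_inter_marks_eq hA (κ := fun e ω => D.N e (T ω).toNNReal ω - 1)
    (fun e => (measurable_from_top (f := fun j => j - 1)).comp (hN e)) S y]
  congr 1
  ext ω
  simp only [mem_inter_iff, mem_ofPred_eq]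
  refine and_congr_right fun hω => forall₂_congr fun e he => ?_
  obtain ⟨j, hj⟩ := Nat.exists_eq_add_of_le' (h ω hω e he)
  simp only [edge, edgeFrom, hj, Nat.add_sub_cancel]

lemma measurable_updateAlg_of_le_iff {T : Ω → ℝ≥0∞} (S : Finset (VertexPair n))
    (h : ∀ (t : ℝ≥0) ω, T ω ≤ t ↔ ∀ e ∈ S, 1 ≤ D.N e t ω) :
    Measurable[⨆ e, D.updateAlg e] T := by
  refine @measurable_of_Iic _ _ _ _ _ (⨆ e, D.updateAlg e) _ _ _ _ fun a => ?_
  induction a with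
  | top => simp
  | coe a =>
    have e1 : T ⁻¹' Iic (a : ℝ≥0∞) = ⋂ e ∈ S, {ω | 1 ≤ D.N e a ω} := by
      ext ω
      simp [h]
    rw [e1]
    exact Finset.measurableSet_biInter (m := ⨆ e, D.updateAlg e) S fun e _ =>
      le_iSup D.updateAlg e _ (D.measurable_N_updateAlg e a (measurableSet_Ici (a := 1)))

/-- At the first time `T` at which all the pairs in `S` have been updated, the states of these pairs
are distributed as independent updates and are independent of `T`. -/
lemma measure_edges_at_updateTime [IsProbabilityMeasure μ] {T : Ω → ℝ≥0∞}
    (S : Finset (VertexPair n)) (h : ∀ (t : ℝ≥0) ω, T ω ≤ t ↔ ∀ e ∈ S, 1 ≤ D.N e t ω)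
    (y : VertexPair n → Bool) {C : Set ℝ≥0∞} (hC : MeasurableSet C) (hC' : ∞ ∉ C) :
    μ {ω | T ω ∈ C ∧ ∀ e ∈ S, D.edge e (T ω).toNNReal ω = y e} =
      μ {ω | T ω ∈ C} * ∏ e ∈ S, updateLaw n α β (y e) := by
  have hT := D.measurable_updateAlg_of_le_iff S h
  refine D.measure_inter_edges_eq (hT hC) hT S (fun ω hω => ?_) y
  have hne : T ω ≠ ∞ := fun h => hC' (h ▸ hω)
  exact (h (T ω).toNNReal ω).1 (ENNReal.coe_toNNReal hne).ge

/-! ### Fastest times to stationarity -/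

lemma isUniqueStationaryDistribution_edge [IsProbabilityMeasure μ]
    (hr : 0 < updateRate n α β) (e : VertexPair n) :
    IsUniqueStationaryDistribution (D.edgeTransition e) (updateLaw n α β) := by
  refine isUniqueStationaryDistribution_of_le (fun t b => ?_) _ (tendsto_one_sub_noUpdateProb hr)
    fun k a b => ?_
  · simp only [D.edgeTransition_eq hr]
    exact sum_updateLaw_mul_edgeKernel hr t b
  · rw [D.edgeTransition_eq hr]
    exact le_add_self

/-- Dropping the no-update term of every factor leaves `(1 - q) ^ N` times the product law, where
`q` is the no-update probability; the power tends to 1. -/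
lemma isUniqueStationaryDistribution_graph [IsProbabilityMeasure μ]
    (hr : 0 < updateRate n α β) :
    IsUniqueStationaryDistribution D.graphTransition (graphLaw n α β) := by
  have hc := ENNReal.Tendsto.pow (n := Fintype.card (VertexPair n))
    (tendsto_one_sub_noUpdateProb (n := n) (α := α) (β := β) hr)
  rw [one_pow] at hc
  refine isUniqueStationaryDistribution_of_le (fun t y => ?_) _ hc fun k x y => ?_
  · simp only [D.graphTransition_eq hr, graphLaw_apply, ← Finset.prod_mul_distrib]
    rw [← Fintype.prod_sum fun e a => updateLaw n α β a * edgeKernel n α β t a (y e)]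
    exact Finset.prod_congr rfl fun e _ => sum_updateLaw_mul_edgeKernel hr t (y e)
  · rw [D.graphTransition_eq hr, graphLaw_apply, ← Finset.card_univ, ← Finset.prod_const,
      ← Finset.prod_mul_distrib]
    exact Finset.prod_le_prod' fun e _ => le_add_self

lemma edge_eventually_eq (e : VertexPair n) (ω : Ω) (t : ℝ≥0) :
    ∀ᶠ s in nhdsWithin t (Ici t), D.edge e s ω = D.edge e t ω := by
  filter_upwards [(D.poisson e).eventually_eq ω t] with s hs
  simp only [edge, edgeFrom, hs]

lemma graph_eventually_eq (ω : Ω) (t : ℝ≥0) :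
    ∀ᶠ s in nhdsWithin t (Ici t), D.graph s ω = D.graph t ω := by
  filter_upwards [Filter.eventually_all.2 fun e => D.edge_eventually_eq e ω t] with s hs
  exact funext hs

lemma graph_zero (ω : Ω) : D.graph 0 ω = D.init ω := by
  funext e
  simp only [graph, edge, edgeFrom, (D.poisson e).zero]

lemma ae_init_eq [IsProbabilityMeasure μ] {σ : GraphState n}
    (hσ : μ {ω | D.graph 0 ω = σ} = 1) : ∀ᵐ ω ∂μ, D.init ω = σ := by
  simp only [graph_zero] at hσ
  have h : MeasurableSet {ω | D.init ω = σ} := D.measurable_init (measurableSet_singleton σ)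
  exact (prob_compl_eq_zero_iff h).2 hσ

lemma isFastestTimeToStationarity_edge [IsProbabilityMeasure μ] (hr : 0 < updateRate n α β)
    (hα : 0 < α) (hβ : 0 < β) {σ : GraphState n} (hσ : μ {ω | D.graph 0 ω = σ} = 1)
    (e : VertexPair n) :
    IsFastestTimeToStationarity μ D.filtration (D.edge e) (updateLaw n α β) (D.firstUpdate e) := by
  have hiff : ∀ (t : ℝ≥0) ω, D.firstUpdate e ω ≤ t ↔ ∀ e' ∈ ({e} : Finset (VertexPair n)),
      1 ≤ D.N e' t ω := fun t ω => by simp [firstUpdate_le_iff]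
  have hfin : μ {ω | D.firstUpdate e ω < ∞} = 1 :=
    measure_lt_top_eq_one (tendsto_one_sub_noUpdateProb hr) fun k => D.measure_firstUpdate_le hr e k
  have hlaw : ∀ (C : Set ℝ≥0∞) (_ : MeasurableSet C) (_ : ∞ ∉ C) (b : Bool),
      μ {ω | D.firstUpdate e ω ∈ C ∧ D.edge e (D.firstUpdate e ω).toNNReal ω = b} =
        μ {ω | D.firstUpdate e ω ∈ C} * updateLaw n α β b := fun C hC hC' b => by
    simpa using D.measure_edges_at_updateTime {e} hiff (fun _ => b) hC hC'
  have hsst : IsStrongStationaryTime μ D.filtration (D.edge e) (updateLaw n α β)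
      (D.firstUpdate e) := by
    refine isStrongStationaryTime_of_measure_lt_top_eq_one (D.measurable_edge e) (fun t => ?_) hfin
      (fun t b => hlaw (Iic t) measurableSet_Iic (by simp) b) (fun b => ?_)
    · simp only [firstUpdate_le_iff]
      exact D.measurableSet_filtration_lt e 0 le_rfl
    -- The choice `C = Iio ∞` gives the law of the state on all of `{T < ∞}`.
    · have h1 := hlaw (Iio ∞) measurableSet_Iio (by simp) b
      simp only [mem_Iio] at h1
      rw [h1, hfin, one_mul]
  refine hsst.isFastestTimeToStationarity (D.hasMarkovProperty_edge hr e)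
    (fun _ _ _ => prob_le_one) ((D.isUniqueStationaryDistribution_edge hr e _).2 rfl)
    (D.edge_eventually_eq e) (!σ e) (updateLaw_ne_zero hα hβ e _) fun t => ?_
  -- The state opposite to the initial one can be reached only through an update, so the no-update
  -- term of the kernel vanishes and the separation bound is attained.
  have h1 : μ {ω | D.edge e t ω = !σ e} = D.edgeTransition e t (σ e) (!σ e) := by
    refine measure_congr ?_
    filter_upwards [D.ae_init_eq hσ] with ω hω
    have : D.edge e t ω = D.edgeFrom (σ e) e t ω := by rw [edge, hω]
    exact congrArg (· = !σ e) this
  rw [h1, D.edgeTransition_eq hr, D.measure_firstUpdate_le hr]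
  simp [edgeKernel]

lemma isFastestTimeToStationarity_graph [IsProbabilityMeasure μ] (hr : 0 < updateRate n α β)
    (hα : 0 < α) (hβ : 0 < β) {σ : GraphState n} (hσ : μ {ω | D.graph 0 ω = σ} = 1) :
    IsFastestTimeToStationarity μ D.filtration D.graph (graphLaw n α β) D.maxFirstUpdate := by
  have hiff : ∀ (t : ℝ≥0) ω, D.maxFirstUpdate ω ≤ t ↔
      ∀ e ∈ (Finset.univ : Finset (VertexPair n)), 1 ≤ D.N e t ω := fun t ω => by
    simp [maxFirstUpdate_le_iff]
  have hc := ENNReal.Tendsto.pow (n := Fintype.card (VertexPair n))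
    (tendsto_one_sub_noUpdateProb (n := n) (α := α) (β := β) hr)
  rw [one_pow] at hc
  have hfin : μ {ω | D.maxFirstUpdate ω < ∞} = 1 :=
    measure_lt_top_eq_one hc fun k => D.measure_maxFirstUpdate_le hr k
  have hlaw : ∀ (C : Set ℝ≥0∞) (_ : MeasurableSet C) (_ : ∞ ∉ C) (y : GraphState n),
      μ {ω | D.maxFirstUpdate ω ∈ C ∧ D.graph (D.maxFirstUpdate ω).toNNReal ω = y} =
        μ {ω | D.maxFirstUpdate ω ∈ C} * graphLaw n α β y := fun C hC hC' y => by
    rw [graphLaw_apply, ← D.measure_edges_at_updateTime Finset.univ hiff y hC hC']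
    simp only [funext_iff, graph, Finset.mem_univ, true_imp_iff]
  have hsst : IsStrongStationaryTime μ D.filtration D.graph (graphLaw n α β)
      D.maxFirstUpdate := by
    refine isStrongStationaryTime_of_measure_lt_top_eq_one D.measurable_graph (fun t => ?_) hfin
      (fun t y => hlaw (Iic t) measurableSet_Iic (by simp) y) (fun y => ?_)
    · simp only [maxFirstUpdate_le_iff]
      rw [show {ω | ∀ e, 1 ≤ D.N e t ω} = ⋂ e, {ω | 1 ≤ D.N e t ω} by ext ω; simp]
      exact MeasurableSet.iInter (m := D.filtration t) fun e =>
        D.measurableSet_filtration_lt e 0 le_rfl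
    · have h1 := hlaw (Iio ∞) measurableSet_Iio (by simp) y
      simp only [mem_Iio] at h1
      rw [h1, hfin, one_mul]
  refine hsst.isFastestTimeToStationarity (D.hasMarkovProperty_graph hr)
    (fun _ _ _ => prob_le_one) ((D.isUniqueStationaryDistribution_graph hr _).2 rfl)
    D.graph_eventually_eq (fun e => !σ e) ?_ fun t => ?_
  · rw [graphLaw_apply]
    exact Finset.prod_ne_zero_iff.2 fun e _ => updateLaw_ne_zero hα hβ e _
  -- In the complementary graph every pair differs from its initial state, so the no-update term
  -- vanishes in each factor and the product is `P(T ≤ t) π(y)`.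
  have h1 : μ {ω | D.graph t ω = fun e => !σ e} = D.graphTransition t σ (fun e => !σ e) := by
    refine measure_congr ?_
    filter_upwards [D.ae_init_eq hσ] with ω hω
    have : D.graph t ω = fun e => D.edgeFrom (σ e) e t ω := by
      funext e
      rw [graph, edge, hω]
    exact congrArg (· = fun e => !σ e) this
  rw [h1, D.graphTransition_eq hr, D.measure_maxFirstUpdate_le hr, graphLaw_apply,
    ← Finset.card_univ, ← Finset.prod_const, ← Finset.prod_mul_distrib]
  exact Finset.prod_congr rfl fun e _ => by simp [edgeKernel]

end DynamicERGraph

theorem theorem1 {Ω : Type*} [MeasurableSpace Ω] (μ : Measure Ω) [IsProbabilityMeasure μ]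
    (n : ℕ) (hn : 0 < n) (α β : ℝ) (hα : 0 < α) (hβ : 0 < β)
    (D : DynamicERGraph n α β μ) (σ : GraphState n) (hσ : μ {ω | D.graph 0 ω = σ} = 1) :
    (∀ e : VertexPair n, ∃ π : PMF Bool,
      IsUniqueStationaryDistribution (D.edgeTransition e) π ∧
      IsFastestTimeToStationarity μ D.filtration (D.edge e) π (D.firstUpdate e)) ∧
    (∃ π : PMF (GraphState n),
      IsUniqueStationaryDistribution D.graphTransition π ∧
      IsFastestTimeToStationarity μ D.filtration D.graph π D.maxFirstUpdate) ∧
    (∀ t : ℝ≥0, μ {ω | D.maxFirstUpdate ω ≤ (t : ℝ≥0∞)} =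
      ENNReal.ofReal
        ((1 - Real.exp (-(α + β / ((n : ℝ) - 1)) * (t : ℝ))) ^ (n.choose 2))) := by
  have hr := updateRate_pos hn hα hβ
  refine ⟨fun e => ⟨_, D.isUniqueStationaryDistribution_edge hr e,
    D.isFastestTimeToStationarity_edge hr hα hβ hσ e⟩, ⟨_,
    D.isUniqueStationaryDistribution_graph hr,
    D.isFastestTimeToStationarity_graph hr hα hβ hσ⟩, fun t => ?_⟩
  have h0 : 0 ≤ 1 - Real.exp (-(updateRate n α β * t)) := by
    rw [sub_nonneg, Real.exp_le_one_iff, neg_nonpos]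
    exact mul_nonneg hr.le t.2
  rw [D.measure_maxFirstUpdate_le hr, one_sub_noUpdateProb, ← ENNReal.ofReal_pow h0,
    Sym2.card_subtype_not_diag, Fintype.card_fin, ← neg_mul, updateRate]
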